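/- **Theorem (Soundness of the Klaim-DB type system).** Let $\Delta$ be a family of (possibly recursive) procedure definitions $A(var_1:\tau_1,\dots,var_n:\tau_n)\triangleq P$ with pairwise distinct parameters, let $\nabla$ be a partial function from table identifiers to schemas, and let $N,N'$ be Klaim-DB nets. If $[],\nabla\vdash N$ and $\vdash N\rightarrow^{*}N'$, then $\mathit{ok}(N')$, i.e. there is no net $N''$ with $N'\equiv N''\,||\,\mathit{ERR}$. *Syntax.* Nets $N::=\mathsf{nil}\mid \mathit{ERR}\mid N_1||N_2\mid(\nu l)N\mid l::C$; components $C::=P\mid(I,R)\mid C_1|C_2$, with interface $I=(tid,sk)$ and $R$ a finite multiset of rows (tuples of constants); processes $P::=\mathsf{nil}\mid a.P\mid A(\tilde e)\mid\mathsf{foreach}(TB,T,\psi,\preceq):P\mid P_1;P_2$; actions $a::=\mathsf{insert}(tid@\ell,t)\mid\mathsf{delete}(tid@\ell,T,\psi)\mid\mathsf{select}(\widetilde{TB},T,\psi,t,!tbv)\mid\mathsf{update}(tid@\ell,T,\psi,t)\mid\mathsf{aggr}(tid@\ell,T,\psi,f,T')\mid\mathsf{create}(tid@\ell,sk)\mid\mathsf{drop}(tid@\ell)\mid\mathsf{eval}(P)@\ell$;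 tables $TB::=tid@\ell\mid tbv\mid(I,R)$; $\ell$ is a locality $l$ or a locality variable $u$. A template $T$ is a list of fields $!x$ (data variable) and $!u$ without repetition. A tuple $t$ is a list of expressions $e::=$ constant $\mid x\mid u\mid e_1\cdot e_2\mid e_1\,aop\,e_2\mid\{e_1,\dots,e_n\}$; constants are integers, strings, table identifiers, localities and finite multisets of these. Predicates $\psi::=\mathsf{true}\mid e_1\,cop\,e_2\mid e_1\in e_2\mid\neg\psi\mid\psi_1\wedge\psi_2$. $T$ binds in $\psi$, in $t$ and in the loop body; $T'$ and $!tbv$ bind in the continuation. An aggregator $f:\{\tau_1\}\to\tau_2$ is a function that comes with its signature and maps multisets of rows of type $\tau_1$ to rows of type $\tau_2$. Types: $\tau_d\in\{Int,String,Loc,Id\}$, $\tau_m::=\tau_d\mid\{\tau_d\}$; schemas are products $\tau_m^1\times\dots\times\tau_m^n$. *Evaluation and matching.* $[\![\cdot]\!]$ gives constants, truth values and rows, or $err$ if an operand has the wrong type: concatenation needs strings, arithmetic needs integers (division by $0$ gives $0$), the elements of a multiset and the two sides of a comparison need a common type $\tau_d$, $e_1\in e_2$ needs a multiset of values of the type of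 $e_1$; $err$ propagates. $v\Vdash\tau$ says that the constant (or, componentwise, the row) $v$ has type $\tau$; $!x\Vdash\tau_m$ iff $\tau_m\ne Loc$, and $!u\Vdash\tau_m$ iff $\tau_m=Loc$, extended componentwise to templates. For a row $r$, $r/T$ is the substitution of the components of $r$ for the variables of $T$; it is $err$ if the lengths differ, if $!x$ meets a locality or a multiset that is not homogeneous, or if $!u$ meets anything but a locality. *Structural congruence* $\equiv$ is the least congruence on nets containing $\alpha$-equivalence, commutativity and associativity of $||$, $N||\mathsf{nil}\equiv N$, $(\nu l_1)(\nu l_2)N\equiv(\nu l_2)(\nu l_1)N$, $N_1||(\nu l)N_2\equiv(\nu l)(N_1||N_2)$ for $l$ not free in $N_1$, $l::(C_1|C_2)\equiv l::C_1||l::C_2$ and $l::(P|\mathsf{nil})\equiv l::P$. *Reduction* $N_{env}\vdash N\to N'$ is the least relation given by the following rules; $\vdash N\to N'$ means $\mathsf{nil}\vdash N\to N'$, and $\to^*$ is its reflexive transitive closure. In the first five rules a net $l_1::a.P\,||\,l_2::(I,R)$ with $I.tid=tid$ and $\ell=l_2$ reduces to $\mathit{ERR}$ if the stated error condition holds, and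 otherwise to $l_1::P\,||\,l_2::(I,R')$ for the stated $R'$. - insert: error if not $[\![t]\!]\Vdash I.sk$; $R'=R\uplus\{[\![t]\!]\}$. - delete: error if $T\not\Vdash I.sk$, or $r/T=err$ or $[\![\psi(r/T)]\!]=err$ for some $r\in R$; $R'$ consists of the $r\in R$ with $[\![\psi(r/T)]\!]\neq tt$. - update: error as for delete, or if for some $r\in R$ the value $[\![t(r/T)]\!]$ is $err$, or $[\![\psi(r/T)]\!]=tt$ and $[\![t(r/T)]\!]\not\Vdash I.sk$; $R'$ arises from $R$ by replacing each $r$ with $[\![\psi(r/T)]\!]=tt$ by $[\![t(r/T)]\!]$. - aggr ($f:\{\tau_1\}\to\tau_2$): error as for delete, or if for some $r\in R$, $r\not\Vdash\tau_1$ or $T'\not\Vdash\tau_2$; $R'=R$ and the continuation becomes $P(r'/T')$, where $r'$ is the value of $f$ on the multiset of the $r\in R$ with $[\![\psi(r/T)]\!]=tt$ (there is no such step if $r'/T'=err$). - drop: no error; the result is $l_1::P||l_2::\mathsf{nil}$. - select: $l_0::\mathsf{select}(\dots).P$ in parallel with tables $l_i::(I_i,R_i)$, $i\le k$, such that each element of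 $\widetilde{TB}$ is a concrete table or some $I_i.tid@l_i$. Let $sk$ and $Q$ be the flattened products of the schemas and of the data sets of $\widetilde{TB}$. The result is $\mathit{ERR}$ if $T\not\Vdash sk$ or for some $r\in Q$ one of $r/T$, $[\![\psi(r/T)]\!]$, $[\![t(r/T)]\!]$ is $err$. Otherwise, if $sk\!\downarrow^T_t$ is defined, $P$ becomes $P[(I',R')/tbv]$ with $I'=(\bot,sk\!\downarrow^T_t)$ and $R'$ the multiset of the $[\![t(r/T)]\!]$ for $r\in Q$ with $[\![\psi(r/T)]\!]=tt$; the tables are unchanged. Here $sk\!\downarrow^T_t$ is defined if $T$ has as many components as $sk$, $t$ has no more components than $T$, and each component of $t$ is a constant, contributing a type that it has, or a variable bound in $T$, contributing the corresponding component of $sk$. - create: $l_1::\mathsf{create}(tid@l_2,sk).P||l_2::\mathsf{nil}\to l_1::P||l_2::((tid,sk),\emptyset)$ if $N_{env}$ has no table $tid$ at $l_2$, and $\to l_1::P||l_2::\mathsf{nil}$ otherwise. - eval: $l_1::\mathsf{eval}(P)@l_2.P'||l_2::\mathsf{nil}\to l_1::P'||l_2::P$ if $P$ has no free variables. - foreach: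 if $r_0$ is $\preceq$-minimal in $R$, $r_0/T\ne err$ and $[\![\psi(r_0/T)]\!]=tt$, then $l::\mathsf{foreach}((I,R),T,\psi,\preceq):P\to l::P(r_0/T);\mathsf{foreach}((I,R\setminus\{r_0\}),T,\psi,\preceq):P$. If $[\![\psi(r/T)]\!]=tt$ for no $r\in R$, it reduces to $\mathit{ERR}$ if $r/T=err$ or $[\![\psi(r/T)]\!]=err$ for some $r\in R$, and to $l::\mathsf{nil}$ otherwise. - sequence: if $N_{env}\vdash l::P_1||N\to l::P_1'||N'$ then $N_{env}\vdash l::P_1;P_2||N\to l::P_1';P_2||N'$ when $P_1'\ne\mathsf{nil}$, and $\to l::P_2||N'$ when $P_1'=\mathsf{nil}$. - call: $l::A(\tilde e)\to l::P[\tilde v/\widetilde{var}]$ if $A(\widetilde{var:\tau})\triangleq P$ and $[\![\tilde e]\!]=\tilde v$. - If $N_2\vdash N_1\to N_1'$ then $\mathsf{nil}\vdash N_1||N_2\to N_1'||N_2$; reduction is closed under $(\nu l)$ and under $\equiv$ on both sides. *Typing.* A typing environment $\Gamma$ assigns types to data variables, $Loc$ to locality variables and schemas to table variables; $[]$ is empty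 and $\Gamma,\Gamma'$ is extension. Expressions, predicates and tuples have the evident types (a data variable cannot be used at type $Loc$; both sides of $cop$ have the same $\tau_d$; in $e_1\in e_2$ they have types $\tau_d$ and $\{\tau_d\}$). $sk\vdash T\triangleright\Gamma'$ holds if $T\Vdash sk$ and $\Gamma'$ gives each variable of $T$ the corresponding component of $sk$. A table $tid@\ell$ has schema $\nabla(tid)$, $tbv$ has $\Gamma(tbv)$, and $(I,R)$ has $I.sk$ provided that all rows have type $I.sk$ and $\nabla(I.tid)=I.sk$ unless $I.tid=\bot$. Every $\ell$ has type $Loc$. Moreover: - insert: $t$ has type $\nabla(tid)$. In delete, update and aggr, $\nabla(tid)\vdash T\triangleright\Gamma'$ and $\psi$ is well typed in $\Gamma,\Gamma'$; for update, $t$ has type $\nabla(tid)$ in $\Gamma,\Gamma'$; for aggr, $f:\{\nabla(tid)\}\to\tau'$ and $\tau'\vdash T'\triangleright\Gamma''$, and the continuation is typed in $\Gamma,\Gamma''$. - select: $T$ is typed by the flattened product of the schemas of $\widetilde{TB}$, giving $\Gamma'$; $\psi$ is well typed and $t$ has a type $\tau'$ in $\Gamma,\Gamma'$; the continuation is typed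 in $\Gamma,tbv:\tau'$. - create: $sk=\nabla(tid)$. eval: $P$ is well typed in $\Gamma$. foreach: $TB$ has a schema $sk$, $sk\vdash T\triangleright\Gamma'$, and $\psi$ and the body are well typed in $\Gamma,\Gamma'$. $P_1;P_2$: both are well typed in $\Gamma$. - $A(\tilde e)$, with $A(\widetilde{var:\tau})\triangleq P$: each $e_i$ has type $\tau_i$ in $\Gamma$ and $P$ is well typed in $[\widetilde{var:\tau}]$. This is read coinductively, so that recursive procedures can be well typed. - A component $(I,R)$ is well typed if all rows have type $I.sk$ and $\nabla(I.tid)=I.sk$ (so $I.tid\neq\bot$). $C_1|C_2$, $N_1||N_2$, $(\nu l)N$ and $l::C$ are well typed if their parts are, $\mathsf{nil}$ is well typed, and $\mathit{ERR}$ is not. -/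

import Mathlib

namespace KlaimDB

/-! ## Names, types and values -/

/-- The disjoint sets of names of the language: localities, data variables, locality variables,
table variables, table identifiers and procedure names. -/
structure Names where
  Loc : Type
  DVar : Type
  LVar : Type
  TVar : Type
  Tid : Type
  Pid : Type
  infinite_loc : Infinite Loc

/-- Data types `Int`, `String`, `Loc`, `Id`. -/
inductive DTy where
  | int | string | loc | id

/-- Multiset types: a data type, or the type of multisets over a data type. -/
inductive MTy where
  | data (τ : DTy)
  | mset (τ : DTy)

/-- Product types `τ₁ × ... × τₙ`. They serve as schemas and as the types of tuples. Concatenation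
of lists is the flattening of a product of products. -/
abbrev Schema := List MTy

/-- Constants that are not multisets. -/
inductive DVal (S : Names) where
  | num (n : ℤ)
  | str (s : String)
  | tid (i : S.Tid)
  | loc (l : S.Loc)

/-- Constants. -/
inductive Val (S : Names) where
  | data (d : DVal S)
  | mset (m : Multiset (DVal S))

/-- Evaluated tuples, i.e. the rows of tables. -/
abbrev Row (S : Names) := List (Val S)

/-- Data sets of tables. -/
abbrev Data (S : Names) := Multiset (Row S)

section
variable {S : Names}

def DVal.ty : DVal S → DTy
  | .num _ => .int
  | .str _ => .string
  | .tid _ => .id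
  | .loc _ => .loc

/-- Well-sortedness `v ⊩ τ` of constants. The empty multiset has every type `{τ}`. -/
def Val.HasSort : Val S → MTy → Prop
  | .data d, .data τ => d.ty = τ
  | .mset m, .mset τ => ∀ d ∈ m, d.ty = τ
  | _, _ => False

/-- A constant is proper if it has some sort (heterogeneous multisets are not proper). -/
def Val.Proper (v : Val S) : Prop := ∃ τ, v.HasSort τ

/-- Well-sortedness `t ⊩ τ₁ × ... × τₙ` of evaluated tuples. -/
def RowHasSort (t : Row S) (sk : Schema) : Prop := List.Forall₂ Val.HasSort t sk

/-- Renaming of localities in constants. -/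
def DVal.rename (π : Equiv.Perm S.Loc) : DVal S → DVal S
  | .loc l => .loc (π l)
  | d => d

def Val.rename (π : Equiv.Perm S.Loc) : Val S → Val S
  | .data d => .data (d.rename π)
  | .mset m => .mset (m.map (DVal.rename π))

def Row.rename (π : Equiv.Perm S.Loc) (t : Row S) : Row S := t.map (Val.rename π)

theorem DVal.ty_rename (π : Equiv.Perm S.Loc) (d : DVal S) : (d.rename π).ty = d.ty := by
  cases d <;> rfl

theorem Val.hasSort_rename (π : Equiv.Perm S.Loc) (v : Val S) (τ : MTy) :
    (v.rename π).HasSort τ ↔ v.HasSort τ := by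
  cases v <;> cases τ <;> simp [Val.rename, Val.HasSort, DVal.ty_rename]

theorem rowHasSort_rename (π : Equiv.Perm S.Loc) (t : Row S) (sk : Schema) :
    RowHasSort (Row.rename π t) sk ↔ RowHasSort t sk := by
  simp only [RowHasSort, Row.rename, List.forall₂_map_left_iff, Val.hasSort_rename]

end

/-- Aggregator functions `f : {dom} → cod`: functions from multisets of rows to rows, given with
their signature, that send multisets of rows of type `dom` to rows of type `cod`. -/
structure Agg (S : Names) where
  dom : Schema
  cod : Schema
  fn : Data S → Row S
  maps : ∀ R : Data S, (∀ t ∈ R, RowHasSort t dom) → RowHasSort (fn R) cod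

/-- Binary relations on rows, used as the order in which loops traverse tables. -/
abbrev RowRel (S : Names) := Row S → Row S → Prop

section
variable {S : Names}

/-- Renaming of localities acts on functions and relations by conjugation. -/
def Agg.rename (π : Equiv.Perm S.Loc) (f : Agg S) : Agg S where
  dom := f.dom
  cod := f.cod
  fn R := Row.rename π (f.fn (R.map (Row.rename π.symm)))
  maps R hR := by
    rw [rowHasSort_rename]
    apply f.maps
    intro t ht
    obtain ⟨s, hs, rfl⟩ := Multiset.mem_map.1 ht
    exact (rowHasSort_rename _ _ _).2 (hR s hs)

def RowRel.rename (π : Equiv.Perm S.Loc) (r : RowRel S) : RowRel S :=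
  fun a b => r (Row.rename π.symm a) (Row.rename π.symm b)

open Classical in
/-- The localities on which a function depends: those for which swapping with another locality
changes the function for infinitely many choices of the other locality. -/
noncomputable def Agg.locs (f : Agg S) : Set S.Loc :=
  {l | {l' | f.rename (Equiv.swap l l') ≠ f}.Infinite}

open Classical in
/-- The localities on which a relation depends. -/
noncomputable def RowRel.locs (r : RowRel S) : Set S.Loc :=
  {l | {l' | RowRel.rename (Equiv.swap l l') r ≠ r}.Infinite}

end

/-! ## Syntax -/

/-- Arithmetic operations; division by zero yields zero. -/
inductive AOp where
  | add | sub | mul | div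

/-- Comparisons. -/
inductive COp where
  | eq | lt | le

/-- Expressions. -/
inductive Expr (S : Names) where
  | const (v : Val S)
  | dvar (x : S.DVar)
  | lvar (u : S.LVar)
  | concat (e₁ e₂ : Expr S)
  | arith (op : AOp) (e₁ e₂ : Expr S)
  | mset (es : List (Expr S))

/-- `ℓ`: a locality or a locality variable. -/
inductive LExp (S : Names) where
  | loc (l : S.Loc)
  | var (u : S.LVar)

/-- Predicates. -/
inductive Pred (S : Names) where
  | tt
  | cmp (op : COp) (e₁ e₂ : Expr S)
  | mem (e₁ e₂ : Expr S)
  | neg (ψ : Pred S)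
  | and (ψ₁ ψ₂ : Pred S)

/-- Tuples. -/
abbrev Tuple (S : Names) := List (Expr S)

/-- Fields `!x` and `!u` of templates. -/
inductive Field (S : Names) where
  | dvar (x : S.DVar)
  | lvar (u : S.LVar)

/-- Templates; they are linear, i.e. no variable occurs twice. -/
structure Template (S : Names) where
  fields : List (Field S)
  linear : fields.Nodup

/-- Interfaces `(tid, sk)`; `none` is the identifier `⊥` of temporary tables. -/
structure Interface (S : Names) where
  tid : Option S.Tid
  sk : Schema

/-- Tables `tid@ℓ`, `tbv`, `(I, R)`. -/
inductive Table (S : Names) where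
  | ref (tid : S.Tid) (ℓ : LExp S)
  | var (tbv : S.TVar)
  | conc (I : Interface S) (R : Data S)

mutual

/-- Actions. -/
inductive Act (S : Names) where
  | ins (tid : S.Tid) (t : Tuple S) (ℓ : LExp S)
  | del (tid : S.Tid) (T : Template S) (ψ : Pred S) (ℓ : LExp S)
  | sel (TBs : List (Table S)) (T : Template S) (ψ : Pred S) (t : Tuple S) (tbv : S.TVar)
  | upd (tid : S.Tid) (T : Template S) (ψ : Pred S) (t : Tuple S) (ℓ : LExp S)
  | aggr (tid : S.Tid) (T : Template S) (ψ : Pred S) (f : Agg S) (T' : Template S) (ℓ : LExp S)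
  | create (tid : S.Tid) (ℓ : LExp S) (sk : Schema)
  | drop (tid : S.Tid) (ℓ : LExp S)
  | eval (P : Proc S) (ℓ : LExp S)

/-- Processes `nil`, `a.P`, `A(e₁,...,eₙ)`, `foreach(TB, T, ψ, ≼) : P`, `P₁; P₂`. -/
inductive Proc (S : Names) where
  | nil
  | pre (a : Act S) (P : Proc S)
  | call (A : S.Pid) (es : List (Expr S))
  | foreach (TB : Table S) (T : Template S) (ψ : Pred S) (r : RowRel S) (P : Proc S)
  | seq (P₁ P₂ : Proc S)

end

/-- Components. -/
inductive Comp (S : Names) where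
  | proc (P : Proc S)
  | tab (I : Interface S) (R : Data S)
  | par (C₁ C₂ : Comp S)

/-- Nets `nil`, `ERR`, `N₁ || N₂`, `(ν l) N`, `l :: C`. -/
inductive Net (S : Names) where
  | nil
  | err
  | par (N₁ N₂ : Net S)
  | res (l : S.Loc) (N : Net S)
  | node (l : S.Loc) (C : Comp S)

/-- The four kinds of names that can be bound. -/
inductive Name (S : Names) where
  | loc (l : S.Loc)
  | dvar (x : S.DVar)
  | lvar (u : S.LVar)
  | tvar (tbv : S.TVar)

/-- Formal parameters `x : τ` and `u : Loc`. -/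
inductive Param (S : Names) where
  | dvar (x : S.DVar) (τ : MTy)
  | lvar (u : S.LVar)

def Param.name {S : Names} : Param S → Name S
  | .dvar x _ => .dvar x
  | .lvar u => .lvar u

/-- The right-hand side and the parameters of a definition `A(var₁ : τ₁, ..., varₙ : τₙ) ≜ P`. -/
structure ProcDef (S : Names) where
  params : List (Param S)
  distinct : (params.map Param.name).Nodup
  body : Proc S

/-- The procedure definitions of a system. -/
abbrev Defs (S : Names) := S.Pid → Option (ProcDef S)

section
variable {S : Names}

/-! ## Free names -/

def DVal.free : DVal S → Set (Name S)
  | .loc l => {.loc l}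
  | _ => ∅

def Val.free : Val S → Set (Name S)
  | .data d => d.free
  | .mset m => {n | ∃ d ∈ m, n ∈ d.free}

def Data.free (R : Data S) : Set (Name S) := {n | ∃ t ∈ R, ∃ v ∈ t, n ∈ Val.free v}

def Expr.free : Expr S → Set (Name S)
  | .const v => v.free
  | .dvar x => {.dvar x}
  | .lvar u => {.lvar u}
  | .concat e₁ e₂ => e₁.free ∪ e₂.free
  | .arith _ e₁ e₂ => e₁.free ∪ e₂.free
  | .mset es => (es.map (fun e => e.free)).foldr (· ∪ ·) ∅

def LExp.free : LExp S → Set (Name S)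
  | .loc l => {.loc l}
  | .var u => {.lvar u}

def Pred.free : Pred S → Set (Name S)
  | .tt => ∅
  | .cmp _ e₁ e₂ => e₁.free ∪ e₂.free
  | .mem e₁ e₂ => e₁.free ∪ e₂.free
  | .neg ψ => ψ.free
  | .and ψ₁ ψ₂ => ψ₁.free ∪ ψ₂.free

def Tuple.free (t : Tuple S) : Set (Name S) := {n | ∃ e ∈ t, n ∈ Expr.free e}

def Table.free : Table S → Set (Name S)
  | .ref _ ℓ => ℓ.free
  | .var tbv => {.tvar tbv}
  | .conc _ R => Data.free R

def Field.name : Field S → Name S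
  | .dvar x => .dvar x
  | .lvar u => .lvar u

/-- The variables bound by a template. -/
def Template.bound (T : Template S) : Set (Name S) := {n | ∃ W ∈ T.fields, n = W.name}

/-- The variables that an action `a` binds in the continuation `P` of `a.P`. -/
def Act.bound : Act S → Set (Name S)
  | .sel _ _ _ _ tbv => {.tvar tbv}
  | .aggr _ _ _ _ T' _ => T'.bound
  | _ => ∅

mutual

noncomputable def Act.free : Act S → Set (Name S)
  | .ins _ t ℓ => Tuple.free t ∪ ℓ.free
  | .del _ T ψ ℓ => (ψ.free \ T.bound) ∪ ℓ.free
  | .sel TBs T ψ t _ =>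
      {n | ∃ TB ∈ TBs, n ∈ Table.free TB} ∪ ((ψ.free ∪ Tuple.free t) \ T.bound)
  | .upd _ T ψ t ℓ => ((ψ.free ∪ Tuple.free t) \ T.bound) ∪ ℓ.free
  | .aggr _ T ψ f _ ℓ => (ψ.free \ T.bound) ∪ Name.loc '' f.locs ∪ ℓ.free
  | .create _ ℓ _ => ℓ.free
  | .drop _ ℓ => ℓ.free
  | .eval P ℓ => P.free ∪ ℓ.free

noncomputable def Proc.free : Proc S → Set (Name S)
  | .nil => ∅
  | .pre a P => a.free ∪ (P.free \ a.bound)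
  | .call _ es => Tuple.free es
  | .foreach TB T ψ r P =>
      TB.free ∪ Name.loc '' RowRel.locs r ∪ ((ψ.free ∪ P.free) \ T.bound)
  | .seq P₁ P₂ => P₁.free ∪ P₂.free

end

/-- `FV(P) = ∅`: no data, locality or table variable is free in `P`. -/
def Proc.Closed (P : Proc S) : Prop := ∀ n ∈ P.free, ∃ l, n = .loc l

noncomputable def Comp.free : Comp S → Set (Name S)
  | .proc P => P.free
  | .tab _ R => Data.free R
  | .par C₁ C₂ => C₁.free ∪ C₂.free

noncomputable def Net.free : Net S → Set (Name S)
  | .nil => ∅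
  | .err => ∅
  | .par N₁ N₂ => N₁.free ∪ N₂.free
  | .res l N => N.free \ {.loc l}
  | .node l C => {.loc l} ∪ C.free

/-! ## Renaming of names, free or bound -/

end

/-- Kind-preserving permutations of the names. -/
structure Ren (S : Names) where
  loc : Equiv.Perm S.Loc
  dvar : Equiv.Perm S.DVar
  lvar : Equiv.Perm S.LVar
  tvar : Equiv.Perm S.TVar

section
variable {S : Names}

open Classical in
/-- The transposition of two names of the same kind. -/
noncomputable def Ren.swap : Name S → Name S → Ren S
  | .loc a, .loc b => ⟨Equiv.swap a b, 1, 1, 1⟩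
  | .dvar a, .dvar b => ⟨1, Equiv.swap a b, 1, 1⟩
  | .lvar a, .lvar b => ⟨1, 1, Equiv.swap a b, 1⟩
  | .tvar a, .tvar b => ⟨1, 1, 1, Equiv.swap a b⟩
  | _, _ => ⟨1, 1, 1, 1⟩

def Expr.rename (ρ : Ren S) : Expr S → Expr S
  | .const v => .const (v.rename ρ.loc)
  | .dvar x => .dvar (ρ.dvar x)
  | .lvar u => .lvar (ρ.lvar u)
  | .concat e₁ e₂ => .concat (e₁.rename ρ) (e₂.rename ρ)
  | .arith op e₁ e₂ => .arith op (e₁.rename ρ) (e₂.rename ρ)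
  | .mset es => .mset (es.map (fun e => e.rename ρ))

def LExp.rename (ρ : Ren S) : LExp S → LExp S
  | .loc l => .loc (ρ.loc l)
  | .var u => .var (ρ.lvar u)

def Pred.rename (ρ : Ren S) : Pred S → Pred S
  | .tt => .tt
  | .cmp op e₁ e₂ => .cmp op (e₁.rename ρ) (e₂.rename ρ)
  | .mem e₁ e₂ => .mem (e₁.rename ρ) (e₂.rename ρ)
  | .neg ψ => .neg (ψ.rename ρ)
  | .and ψ₁ ψ₂ => .and (ψ₁.rename ρ) (ψ₂.rename ρ)

def Tuple.rename (ρ : Ren S) (t : Tuple S) : Tuple S := t.map (Expr.rename ρ)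

def Data.rename (ρ : Ren S) (R : Data S) : Data S := R.map (Row.rename ρ.loc)

def Table.rename (ρ : Ren S) : Table S → Table S
  | .ref tid ℓ => .ref tid (ℓ.rename ρ)
  | .var tbv => .var (ρ.tvar tbv)
  | .conc I R => .conc I (Data.rename ρ R)

def Field.rename (ρ : Ren S) : Field S → Field S
  | .dvar x => .dvar (ρ.dvar x)
  | .lvar u => .lvar (ρ.lvar u)

theorem Field.rename_injective (ρ : Ren S) : Function.Injective (Field.rename ρ) := by
  intro a b h
  cases a <;> cases b <;> simp_all [Field.rename]

def Template.rename (ρ : Ren S) (T : Template S) : Template S where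
  fields := T.fields.map (Field.rename ρ)
  linear := T.linear.map (Field.rename_injective ρ)

mutual

def Act.rename (ρ : Ren S) : Act S → Act S
  | .ins tid t ℓ => .ins tid (Tuple.rename ρ t) (ℓ.rename ρ)
  | .del tid T ψ ℓ => .del tid (T.rename ρ) (ψ.rename ρ) (ℓ.rename ρ)
  | .sel TBs T ψ t tbv =>
      .sel (TBs.map (Table.rename ρ)) (T.rename ρ) (ψ.rename ρ) (Tuple.rename ρ t) (ρ.tvar tbv)
  | .upd tid T ψ t ℓ =>
      .upd tid (T.rename ρ) (ψ.rename ρ) (Tuple.rename ρ t) (ℓ.rename ρ)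
  | .aggr tid T ψ f T' ℓ =>
      .aggr tid (T.rename ρ) (ψ.rename ρ) (f.rename ρ.loc) (T'.rename ρ) (ℓ.rename ρ)
  | .create tid ℓ sk => .create tid (ℓ.rename ρ) sk
  | .drop tid ℓ => .drop tid (ℓ.rename ρ)
  | .eval P ℓ => .eval (P.rename ρ) (ℓ.rename ρ)

def Proc.rename (ρ : Ren S) : Proc S → Proc S
  | .nil => .nil
  | .pre a P => .pre (a.rename ρ) (P.rename ρ)
  | .call A es => .call A (Tuple.rename ρ es)
  | .foreach TB T ψ r P =>
      .foreach (TB.rename ρ) (T.rename ρ) (ψ.rename ρ) (RowRel.rename ρ.loc r) (P.rename ρ)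
  | .seq P₁ P₂ => .seq (P₁.rename ρ) (P₂.rename ρ)

end

def Comp.rename (ρ : Ren S) : Comp S → Comp S
  | .proc P => .proc (P.rename ρ)
  | .tab I R => .tab I (Data.rename ρ R)
  | .par C₁ C₂ => .par (C₁.rename ρ) (C₂.rename ρ)

def Net.rename (ρ : Ren S) : Net S → Net S
  | .nil => .nil
  | .err => .err
  | .par N₁ N₂ => .par (N₁.rename ρ) (N₂.rename ρ)
  | .res l N => .res (ρ.loc l) (N.rename ρ)
  | .node l C => .node (ρ.loc l) (C.rename ρ)

/-! ## α-equivalence and structural congruence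

α-equivalence is the least congruence that identifies a phrase with the result of transposing in
it two names (of the same kind) that are both not free in it. For instance
`(ν l) N` and `(ν l') N[l'/l]` are identified when `l'` is not free in `N`. The names that an action
binds in its continuation cannot be changed in the action alone. -/

mutual

inductive AlphaAct : Act S → Act S → Prop
  | refl (a : Act S) : AlphaAct a a
  | symm {a b : Act S} : AlphaAct a b → AlphaAct b a
  | trans {a b c : Act S} : AlphaAct a b → AlphaAct b c → AlphaAct a c
  | swap (a : Act S) (m n : Name S) (hm : m ∉ a.free ∪ a.bound) (hn : n ∉ a.free ∪ a.bound) :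
      AlphaAct a (a.rename (Ren.swap m n))
  | eval {P P' : Proc S} (ℓ : LExp S) : AlphaProc P P' → AlphaAct (.eval P ℓ) (.eval P' ℓ)

inductive AlphaProc : Proc S → Proc S → Prop
  | refl (P : Proc S) : AlphaProc P P
  | symm {P Q : Proc S} : AlphaProc P Q → AlphaProc Q P
  | trans {P Q R : Proc S} : AlphaProc P Q → AlphaProc Q R → AlphaProc P R
  | swap (P : Proc S) (m n : Name S) (hm : m ∉ P.free) (hn : n ∉ P.free) :
      AlphaProc P (P.rename (Ren.swap m n))
  | pre {a a' : Act S} {P P' : Proc S} :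
      AlphaAct a a' → AlphaProc P P' → AlphaProc (.pre a P) (.pre a' P')
  | foreach (TB : Table S) (T : Template S) (ψ : Pred S) (r : RowRel S) {P P' : Proc S} :
      AlphaProc P P' → AlphaProc (.foreach TB T ψ r P) (.foreach TB T ψ r P')
  | seq {P₁ P₁' P₂ P₂' : Proc S} :
      AlphaProc P₁ P₁' → AlphaProc P₂ P₂' → AlphaProc (.seq P₁ P₂) (.seq P₁' P₂')

end

inductive AlphaComp : Comp S → Comp S → Prop
  | refl (C : Comp S) : AlphaComp C C
  | proc {P P' : Proc S} : AlphaProc P P' → AlphaComp (.proc P) (.proc P')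
  | par {C₁ C₁' C₂ C₂' : Comp S} :
      AlphaComp C₁ C₁' → AlphaComp C₂ C₂' → AlphaComp (.par C₁ C₂) (.par C₁' C₂')

inductive AlphaNet : Net S → Net S → Prop
  | refl (N : Net S) : AlphaNet N N
  | symm {N M : Net S} : AlphaNet N M → AlphaNet M N
  | trans {N M K : Net S} : AlphaNet N M → AlphaNet M K → AlphaNet N K
  | swap (N : Net S) (m n : Name S) (hm : m ∉ N.free) (hn : n ∉ N.free) :
      AlphaNet N (N.rename (Ren.swap m n))
  | par {N₁ N₁' N₂ N₂' : Net S} :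
      AlphaNet N₁ N₁' → AlphaNet N₂ N₂' → AlphaNet (.par N₁ N₂) (.par N₁' N₂')
  | res (l : S.Loc) {N N' : Net S} : AlphaNet N N' → AlphaNet (.res l N) (.res l N')
  | node (l : S.Loc) {C C' : Comp S} : AlphaComp C C' → AlphaNet (.node l C) (.node l C')

/-- Structural congruence `N ≡ N'`. -/
inductive Cong : Net S → Net S → Prop
  | refl (N : Net S) : Cong N N
  | symm {N M : Net S} : Cong N M → Cong M N
  | trans {N M K : Net S} : Cong N M → Cong M K → Cong N K
  | par {N₁ N₁' N₂ N₂' : Net S} :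
      Cong N₁ N₁' → Cong N₂ N₂' → Cong (.par N₁ N₂) (.par N₁' N₂')
  | res (l : S.Loc) {N N' : Net S} : Cong N N' → Cong (.res l N) (.res l N')
  | par_comm (N₁ N₂ : Net S) : Cong (.par N₁ N₂) (.par N₂ N₁)
  | par_assoc (N₁ N₂ N₃ : Net S) :
      Cong (.par (.par N₁ N₂) N₃) (.par N₁ (.par N₂ N₃))
  | par_nil (N : Net S) : Cong (.par N .nil) N
  | res_comm (l₁ l₂ : S.Loc) (N : Net S) :
      Cong (.res l₁ (.res l₂ N)) (.res l₂ (.res l₁ N))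
  | extrude (l : S.Loc) (N₁ N₂ : Net S) (h : Name.loc l ∉ N₁.free) :
      Cong (.par N₁ (.res l N₂)) (.res l (.par N₁ N₂))
  | alpha {N N' : Net S} : AlphaNet N N' → Cong N N'
  | split (l : S.Loc) (C₁ C₂ : Comp S) :
      Cong (.node l (.par C₁ C₂)) (.par (.node l C₁) (.node l C₂))
  | proc_nil (l : S.Loc) (P : Proc S) :
      Cong (.node l (.par (.proc P) (.proc .nil))) (.node l (.proc P))

/-- `ok(N)`: no parallel component of `N` is `ERR`, up to structural congruence. -/
def Ok (N : Net S) : Prop := ¬ ∃ N' : Net S, Cong N (.par N' .err)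

/-! ## Evaluation; the value `err` is `none` -/

def AOp.apply : AOp → ℤ → ℤ → ℤ
  | .add, a, b => a + b
  | .sub, a, b => a - b
  | .mul, a, b => a * b
  | .div, a, b => a / b

/-- The comparison relations. Orderings relate integers to integers and strings to strings. -/
def COp.Holds : COp → DVal S → DVal S → Prop
  | .eq, d₁, d₂ => d₁ = d₂
  | .lt, .num a, .num b => a < b
  | .lt, .str a, .str b => a < b
  | .le, .num a, .num b => a ≤ b
  | .le, .str a, .str b => a ≤ b
  | _, _, _ => False

open Classical in
/-- The multiset of given evaluation results, if they are constants of the same data type. -/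
noncomputable def evalMset (vs : List (Option (Val S))) : Option (Val S) :=
  match vs.mapM (fun v => match v with
    | some (Val.data d) => some d
    | _ => none) with
  | some ds => if ∃ τ, ∀ d ∈ ds, DVal.ty d = τ then some (.mset (ds : Multiset (DVal S))) else none
  | none => none

open Classical in
noncomputable def Expr.eval : Expr S → Option (Val S)
  | .const v => if v.Proper then some v else none
  | .dvar _ => none
  | .lvar _ => none
  | .concat e₁ e₂ =>
      match e₁.eval, e₂.eval with
      | some (.data (.str a)), some (.data (.str b)) => some (.data (.str (a ++ b)))
      | _, _ => none
  | .arith op e₁ e₂ =>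
      match e₁.eval, e₂.eval with
      | some (.data (.num a)), some (.data (.num b)) => some (.data (.num (op.apply a b)))
      | _, _ => none
  | .mset es => evalMset (es.map (fun e => e.eval))

open Classical in
noncomputable def Pred.eval : Pred S → Option Bool
  | .tt => some true
  | .cmp op e₁ e₂ =>
      match e₁.eval, e₂.eval with
      | some (.data d₁), some (.data d₂) =>
          if d₁.ty = d₂.ty then some (decide (op.Holds d₁ d₂)) else none
      | _, _ => none
  | .mem e₁ e₂ =>
      match e₁.eval, e₂.eval with
      | some (.data d), some (.mset m) =>
          if ∀ d' ∈ m, d'.ty = d.ty then some (decide (d ∈ m)) else none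
      | _, _ => none
  | .neg ψ => ψ.eval.map not
  | .and ψ₁ ψ₂ =>
      match ψ₁.eval, ψ₂.eval with
      | some b₁, some b₂ => some (b₁ && b₂)
      | _, _ => none

noncomputable def Tuple.eval (t : Tuple S) : Option (Row S) := t.mapM Expr.eval

end

/-! ## Substitution -/

/-- Substitutions of constants for data variables, of localities for locality variables and of
concrete tables for table variables. What is substituted is closed, so nothing can be captured. -/
structure Subst (S : Names) where
  dvar : S.DVar → Option (Val S)
  lvar : S.LVar → Option S.Loc
  tvar : S.TVar → Option (Interface S × Data S)

section
variable {S : Names}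

def Subst.empty : Subst S := ⟨fun _ => none, fun _ => none, fun _ => none⟩

open Classical in
noncomputable def Subst.single (x : S.DVar) (v : Val S) : Subst S :=
  { Subst.empty with dvar := fun y => if y = x then some v else none }

open Classical in
noncomputable def Subst.singleLoc (u : S.LVar) (l : S.Loc) : Subst S :=
  { Subst.empty with lvar := fun w => if w = u then some l else none }

open Classical in
noncomputable def Subst.singleTab (tbv : S.TVar) (I : Interface S) (R : Data S) : Subst S :=
  { Subst.empty with tvar := fun w => if w = tbv then some (I, R) else none }

/-- `σ₁σ₂`: first `σ₁`, then `σ₂`. -/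
def Subst.append (σ₁ σ₂ : Subst S) : Subst S where
  dvar x := (σ₁.dvar x).or (σ₂.dvar x)
  lvar u := (σ₁.lvar u).or (σ₂.lvar u)
  tvar b := (σ₁.tvar b).or (σ₂.tvar b)

open Classical in
/-- The substitution under binders for the names in `B`: those names are left alone. -/
noncomputable def Subst.under (σ : Subst S) (B : Set (Name S)) : Subst S where
  dvar x := if Name.dvar x ∈ B then none else σ.dvar x
  lvar u := if Name.lvar u ∈ B then none else σ.lvar u
  tvar b := if Name.tvar b ∈ B then none else σ.tvar b

def Expr.subst (σ : Subst S) : Expr S → Expr S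
  | .const v => .const v
  | .dvar x => match σ.dvar x with
      | some v => .const v
      | none => .dvar x
  | .lvar u => match σ.lvar u with
      | some l => .const (.data (.loc l))
      | none => .lvar u
  | .concat e₁ e₂ => .concat (e₁.subst σ) (e₂.subst σ)
  | .arith op e₁ e₂ => .arith op (e₁.subst σ) (e₂.subst σ)
  | .mset es => .mset (es.map (fun e => e.subst σ))

def LExp.subst (σ : Subst S) : LExp S → LExp S
  | .loc l => .loc l
  | .var u => match σ.lvar u with
      | some l => .loc l
      | none => .var u

def Pred.subst (σ : Subst S) : Pred S → Pred S
  | .tt => .tt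
  | .cmp op e₁ e₂ => .cmp op (e₁.subst σ) (e₂.subst σ)
  | .mem e₁ e₂ => .mem (e₁.subst σ) (e₂.subst σ)
  | .neg ψ => .neg (ψ.subst σ)
  | .and ψ₁ ψ₂ => .and (ψ₁.subst σ) (ψ₂.subst σ)

def Tuple.subst (σ : Subst S) (t : Tuple S) : Tuple S := t.map (Expr.subst σ)

def Table.subst (σ : Subst S) : Table S → Table S
  | .ref tid ℓ => .ref tid (ℓ.subst σ)
  | .var tbv => match σ.tvar tbv with
      | some (I, R) => .conc I R
      | none => .var tbv
  | .conc I R => .conc I R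

mutual

noncomputable def Act.subst : Act S → Subst S → Act S
  | .ins tid t ℓ, σ => .ins tid (Tuple.subst σ t) (ℓ.subst σ)
  | .del tid T ψ ℓ, σ => .del tid T (ψ.subst (σ.under T.bound)) (ℓ.subst σ)
  | .sel TBs T ψ t tbv, σ =>
      .sel (TBs.map (Table.subst σ)) T (ψ.subst (σ.under T.bound))
        (Tuple.subst (σ.under T.bound) t) tbv
  | .upd tid T ψ t ℓ, σ =>
      .upd tid T (ψ.subst (σ.under T.bound)) (Tuple.subst (σ.under T.bound) t) (ℓ.subst σ)
  | .aggr tid T ψ f T' ℓ, σ => .aggr tid T (ψ.subst (σ.under T.bound)) f T' (ℓ.subst σ)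
  | .create tid ℓ sk, σ => .create tid (ℓ.subst σ) sk
  | .drop tid ℓ, σ => .drop tid (ℓ.subst σ)
  | .eval P ℓ, σ => .eval (P.subst σ) (ℓ.subst σ)

noncomputable def Proc.subst : Proc S → Subst S → Proc S
  | .nil, _ => .nil
  | .pre a P, σ => .pre (a.subst σ) (P.subst (σ.under a.bound))
  | .call A es, σ => .call A (Tuple.subst σ es)
  | .foreach TB T ψ r P, σ =>
      .foreach (TB.subst σ) T (ψ.subst (σ.under T.bound)) r (P.subst (σ.under T.bound))
  | .seq P₁ P₂, σ => .seq (P₁.subst σ) (P₂.subst σ)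

end

/-! ## Pattern matching, well-sortedness of templates, products of tables -/

open Classical in
/-- `v / W`. -/
noncomputable def Field.match : Field S → Val S → Option (Subst S)
  | .dvar _, .data (.loc _) => none
  | .dvar x, v => if v.Proper then some (Subst.single x v) else none
  | .lvar u, .data (.loc l) => some (Subst.singleLoc u l)
  | .lvar _, _ => none

noncomputable def matchFields : List (Field S) → Row S → Option (Subst S)
  | [], [] => some Subst.empty
  | W :: Ws, v :: vs =>
      match W.match v, matchFields Ws vs with
      | some σ₁, some σ₂ => some (σ₁.append σ₂)
      | _, _ => none
  | _, _ => none

/-- `t / T`. -/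
noncomputable def Template.match (T : Template S) (t : Row S) : Option (Subst S) :=
  matchFields T.fields t

/-- The value of `ψ(t/T)`; it is `err` if `t/T` is. -/
noncomputable def Pred.evalAt (ψ : Pred S) (T : Template S) (t : Row S) : Option Bool :=
  (T.match t).bind fun σ => (ψ.subst σ).eval

/-- The value of `e(t/T)` for a tuple `e`; it is `err` if `t/T` is. -/
noncomputable def Tuple.evalAt (e : Tuple S) (T : Template S) (t : Row S) : Option (Row S) :=
  (T.match t).bind fun σ => Tuple.eval (Tuple.subst σ e)

/-- `W ⊩ τ`. -/
def Field.HasSort : Field S → MTy → Prop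
  | .dvar _, τ => τ ≠ .data .loc
  | .lvar _, τ => τ = .data .loc

/-- `T ⊩ sk`. -/
def Template.HasSort (T : Template S) (sk : Schema) : Prop :=
  List.Forall₂ Field.HasSort T.fields sk

/-- `e ⊩ τ` for a constant expression `e`. -/
def Expr.ConstSort (e : Expr S) (τ : MTy) : Prop :=
  (∃ v, e = .const v ∧ v.HasSort τ) ∨
  (∃ ds : List (DVal S), e = .mset (ds.map fun d => .const (.data d)) ∧
    (Val.mset (ds : Multiset (DVal S))).HasSort τ)

/-- `(τ₁ × ... × τₖ) ↓ᵀₜ = τ'₁ × ... × τ'ₙ`, the projection of a schema. Each component of `t` is a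
constant or a variable bound in `T`. -/
def SkProj (sk : Schema) (T : Template S) (t : Tuple S) (sk' : Schema) : Prop :=
  sk.length = T.fields.length ∧ t.length ≤ T.fields.length ∧
  List.Forall₂ (fun e τ =>
    e.ConstSort τ ∨
    (∃ x, e = .dvar x ∧ (τ, Field.dvar x) ∈ sk.zip T.fields) ∨
    (∃ u, e = .lvar u ∧ (τ, Field.lvar u) ∈ sk.zip T.fields)) t sk'

/-- A table located in a net. -/
abbrev LocTable (S : Names) := S.Loc × Interface S × Data S

/-- The schema and the data set that a table stands for, given a list of located tables. Nothing is
assigned to `tbv`, to `tid@u`, and to references that are not in the list. -/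
inductive Resolves (L : List (LocTable S)) : Table S → Schema × Data S → Prop
  | ref {tid : S.Tid} {l : S.Loc} {I : Interface S} {R : Data S}
      (hL : (l, I, R) ∈ L) (htid : I.tid = some tid) :
      Resolves L (.ref tid (.loc l)) (I.sk, R)
  | conc (I : Interface S) (R : Data S) : Resolves L (.conc I R) (I.sk, R)

/-- The flattened product of schemas. -/
def prodSk (rs : List (Schema × Data S)) : Schema := (rs.map Prod.fst).flatten

/-- The flattened Cartesian product of data sets. -/
def prodData : List (Schema × Data S) → Data S
  | [] => {[]}
  | r :: rs => (r.2 ×ˢ prodData rs).map fun p => p.1 ++ p.2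

/-- `l₁ :: (I₁, R₁) || ... || lₖ :: (Iₖ, Rₖ)`. -/
def tablesNet (L : List (LocTable S)) : Net S :=
  L.foldr (fun p N => .par (.node p.1 (.tab p.2.1 p.2.2)) N) .nil

/-- The pairs of localities and table identifiers in components and nets. -/
def Comp.lid (l : S.Loc) : Comp S → Multiset (S.Loc × Option S.Tid)
  | .proc _ => 0
  | .tab I _ => {(l, I.tid)}
  | .par C₁ C₂ => C₁.lid l + C₂.lid l

def Net.lid : Net S → Multiset (S.Loc × Option S.Tid)
  | .nil => 0
  | .err => 0
  | .par N₁ N₂ => N₁.lid + N₂.lid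
  | .res _ N => N.lid
  | .node l C => C.lid l

/-- `t ∈ Minimal(R, ≼)`. -/
def IsMinimalRow (r : RowRel S) (R : Data S) (t : Row S) : Prop :=
  t ∈ R ∧ ∀ t' ∈ R, r t' t → t' = t

/-- The substitution of arguments for parameters; a locality parameter needs a locality. -/
noncomputable def bindParams : List (Param S) → List (Val S) → Option (Subst S)
  | [], [] => some Subst.empty
  | .dvar x _ :: ps, v :: vs => (bindParams ps vs).map fun σ => (Subst.single x v).append σ
  | .lvar u :: ps, .data (.loc l) :: vs =>
      (bindParams ps vs).map fun σ => (Subst.singleLoc u l).append σ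
  | _, _ => none

/-! ## The situations in which `ERR` is produced -/

def InsErr (t : Tuple S) (sk : Schema) : Prop :=
  ¬ ∃ v, Tuple.eval t = some v ∧ RowHasSort v sk

def DelErr (T : Template S) (ψ : Pred S) (sk : Schema) (R : Data S) : Prop :=
  ¬ T.HasSort sk ∨ ∃ t ∈ R, T.match t = none ∨ ψ.evalAt T t = none

def SelErr (T : Template S) (ψ : Pred S) (t : Tuple S) (sk : Schema) (R : Data S) : Prop :=
  ¬ T.HasSort sk ∨
  ∃ t' ∈ R, T.match t' = none ∨ ψ.evalAt T t' = none ∨ Tuple.evalAt t T t' = none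

def UpdErr (T : Template S) (ψ : Pred S) (t : Tuple S) (sk : Schema) (R : Data S) : Prop :=
  ¬ T.HasSort sk ∨
  ∃ t' ∈ R, T.match t' = none ∨ ψ.evalAt T t' = none ∨ Tuple.evalAt t T t' = none ∨
    (ψ.evalAt T t' = some true ∧ ¬ ∃ v, Tuple.evalAt t T t' = some v ∧ RowHasSort v sk)

def AggrErr (T : Template S) (ψ : Pred S) (f : Agg S) (T' : Template S) (sk : Schema)
    (R : Data S) : Prop :=
  ¬ T.HasSort sk ∨
  ∃ t ∈ R, T.match t = none ∨ ψ.evalAt T t = none ∨ ¬ RowHasSort t f.dom ∨ ¬ T'.HasSort f.cod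

def ForErr (T : Template S) (ψ : Pred S) (R : Data S) : Prop :=
  ∃ t ∈ R, T.match t = none ∨ ψ.evalAt T t = none

open Classical in
/-- The multiset of the values of `t(t'/T)` for the rows `t'` of `R` with `ψ(t'/T)` true. -/
noncomputable def selectRows (T : Template S) (ψ : Pred S) (t : Tuple S) (R : Data S) : Data S :=
  R.filterMap fun t' => if ψ.evalAt T t' = some true then Tuple.evalAt t T t' else none

open Classical in
noncomputable def rowsWhere (T : Template S) (ψ : Pred S) (R : Data S) : Data S :=
  R.filter fun t => ψ.evalAt T t = some true

open Classical in
noncomputable def rowsWhereNot (T : Template S) (ψ : Pred S) (R : Data S) : Data S :=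
  R.filter fun t => ψ.evalAt T t ≠ some true

/-! ## Reduction -/

open Classical in
/-- `Step Δ E N N'`: the net `N` makes a transition to `N'` in the environment `E`, with the
procedure definitions `Δ`. -/
inductive Step (Δ : Defs S) : Net S → Net S → Net S → Prop
  | ins_err {E : Net S} {l₁ l₂ : S.Loc} {tid : S.Tid} {t : Tuple S} {P : Proc S}
      {I : Interface S} {R : Data S} (htid : I.tid = some tid) (h : InsErr t I.sk) :
      Step Δ E
        (.par (.node l₁ (.proc (.pre (.ins tid t (.loc l₂)) P))) (.node l₂ (.tab I R)))
        .err
  | ins {E : Net S} {l₁ l₂ : S.Loc} {tid : S.Tid} {t : Tuple S} {P : Proc S}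
      {I : Interface S} {R : Data S} {v : Row S} (htid : I.tid = some tid)
      (hv : Tuple.eval t = some v) (h : RowHasSort v I.sk) :
      Step Δ E
        (.par (.node l₁ (.proc (.pre (.ins tid t (.loc l₂)) P))) (.node l₂ (.tab I R)))
        (.par (.node l₁ (.proc P)) (.node l₂ (.tab I (R + {v}))))
  | del_err {E : Net S} {l₁ l₂ : S.Loc} {tid : S.Tid} {T : Template S} {ψ : Pred S} {P : Proc S}
      {I : Interface S} {R : Data S} (htid : I.tid = some tid) (h : DelErr T ψ I.sk R) :
      Step Δ E
        (.par (.node l₁ (.proc (.pre (.del tid T ψ (.loc l₂)) P))) (.node l₂ (.tab I R)))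
        .err
  | del {E : Net S} {l₁ l₂ : S.Loc} {tid : S.Tid} {T : Template S} {ψ : Pred S} {P : Proc S}
      {I : Interface S} {R : Data S} (htid : I.tid = some tid) (h : ¬ DelErr T ψ I.sk R) :
      Step Δ E
        (.par (.node l₁ (.proc (.pre (.del tid T ψ (.loc l₂)) P))) (.node l₂ (.tab I R)))
        (.par (.node l₁ (.proc P)) (.node l₂ (.tab I (rowsWhereNot T ψ R))))
  | sel_err {E : Net S} {l₀ : S.Loc} {TBs : List (Table S)} {T : Template S} {ψ : Pred S}
      {t : Tuple S} {tbv : S.TVar} {P : Proc S} {L : List (LocTable S)}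
      {rs : List (Schema × Data S)} (hrs : List.Forall₂ (Resolves L) TBs rs)
      (h : SelErr T ψ t (prodSk rs) (prodData rs)) :
      Step Δ E (.par (.node l₀ (.proc (.pre (.sel TBs T ψ t tbv) P))) (tablesNet L)) .err
  | sel {E : Net S} {l₀ : S.Loc} {TBs : List (Table S)} {T : Template S} {ψ : Pred S}
      {t : Tuple S} {tbv : S.TVar} {P : Proc S} {L : List (LocTable S)}
      {rs : List (Schema × Data S)} {sk' : Schema} (hrs : List.Forall₂ (Resolves L) TBs rs)
      (h : ¬ SelErr T ψ t (prodSk rs) (prodData rs)) (hsk : SkProj (prodSk rs) T t sk') :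
      Step Δ E
        (.par (.node l₀ (.proc (.pre (.sel TBs T ψ t tbv) P))) (tablesNet L))
        (.par
          (.node l₀ (.proc (P.subst
            (Subst.singleTab tbv ⟨none, sk'⟩ (selectRows T ψ t (prodData rs))))))
          (tablesNet L))
  | upd_err {E : Net S} {l₁ l₂ : S.Loc} {tid : S.Tid} {T : Template S} {ψ : Pred S} {t : Tuple S}
      {P : Proc S} {I : Interface S} {R : Data S} (htid : I.tid = some tid)
      (h : UpdErr T ψ t I.sk R) :
      Step Δ E
        (.par (.node l₁ (.proc (.pre (.upd tid T ψ t (.loc l₂)) P))) (.node l₂ (.tab I R)))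
        .err
  | upd {E : Net S} {l₁ l₂ : S.Loc} {tid : S.Tid} {T : Template S} {ψ : Pred S} {t : Tuple S}
      {P : Proc S} {I : Interface S} {R : Data S} (htid : I.tid = some tid)
      (h : ¬ UpdErr T ψ t I.sk R) :
      Step Δ E
        (.par (.node l₁ (.proc (.pre (.upd tid T ψ t (.loc l₂)) P))) (.node l₂ (.tab I R)))
        (.par (.node l₁ (.proc P))
          (.node l₂ (.tab I (rowsWhereNot T ψ R + selectRows T ψ t R))))
  | aggr_err {E : Net S} {l₁ l₂ : S.Loc} {tid : S.Tid} {T T' : Template S} {ψ : Pred S} {f : Agg S}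
      {P : Proc S} {I : Interface S} {R : Data S} (htid : I.tid = some tid)
      (h : AggrErr T ψ f T' I.sk R) :
      Step Δ E
        (.par (.node l₁ (.proc (.pre (.aggr tid T ψ f T' (.loc l₂)) P))) (.node l₂ (.tab I R)))
        .err
  | aggr {E : Net S} {l₁ l₂ : S.Loc} {tid : S.Tid} {T T' : Template S} {ψ : Pred S} {f : Agg S}
      {P : Proc S} {I : Interface S} {R : Data S} {σ : Subst S} (htid : I.tid = some tid)
      (h : ¬ AggrErr T ψ f T' I.sk R) (hσ : T'.match (f.fn (rowsWhere T ψ R)) = some σ) :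
      Step Δ E
        (.par (.node l₁ (.proc (.pre (.aggr tid T ψ f T' (.loc l₂)) P))) (.node l₂ (.tab I R)))
        (.par (.node l₁ (.proc (P.subst σ))) (.node l₂ (.tab I R)))
  | create {E : Net S} {l₁ l₂ : S.Loc} {tid : S.Tid} {sk : Schema} {P : Proc S}
      (h : (l₂, some tid) ∉ E.lid) :
      Step Δ E
        (.par (.node l₁ (.proc (.pre (.create tid (.loc l₂) sk) P))) (.node l₂ (.proc .nil)))
        (.par (.node l₁ (.proc P)) (.node l₂ (.tab ⟨some tid, sk⟩ 0)))
  | create_skip {E : Net S} {l₁ l₂ : S.Loc} {tid : S.Tid} {sk : Schema} {P : Proc S}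
      (h : (l₂, some tid) ∈ E.lid) :
      Step Δ E
        (.par (.node l₁ (.proc (.pre (.create tid (.loc l₂) sk) P))) (.node l₂ (.proc .nil)))
        (.par (.node l₁ (.proc P)) (.node l₂ (.proc .nil)))
  | drop {E : Net S} {l₁ l₂ : S.Loc} {tid : S.Tid} {P : Proc S} {I : Interface S} {R : Data S}
      (htid : I.tid = some tid) :
      Step Δ E
        (.par (.node l₁ (.proc (.pre (.drop tid (.loc l₂)) P))) (.node l₂ (.tab I R)))
        (.par (.node l₁ (.proc P)) (.node l₂ (.proc .nil)))
  | eval {E : Net S} {l₁ l₂ : S.Loc} {P P' : Proc S} (h : P.Closed) :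
      Step Δ E
        (.par (.node l₁ (.proc (.pre (.eval P (.loc l₂)) P'))) (.node l₂ (.proc .nil)))
        (.par (.node l₁ (.proc P')) (.node l₂ (.proc P)))
  | for_tt {E : Net S} {l : S.Loc} {I : Interface S} {R : Data S} {T : Template S} {ψ : Pred S}
      {r : RowRel S} {P : Proc S} {t₀ : Row S} {σ : Subst S} (hmin : IsMinimalRow r R t₀)
      (hσ : T.match t₀ = some σ) (hψ : (ψ.subst σ).eval = some true) :
      Step Δ E
        (.node l (.proc (.foreach (.conc I R) T ψ r P)))
        (.node l (.proc (.seq (P.subst σ) (.foreach (.conc I (R.erase t₀)) T ψ r P))))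
  | for_err {E : Net S} {l : S.Loc} {I : Interface S} {R : Data S} {T : Template S} {ψ : Pred S}
      {r : RowRel S} {P : Proc S} (hff : ¬ ∃ t₀ ∈ R, ψ.evalAt T t₀ = some true)
      (h : ForErr T ψ R) :
      Step Δ E (.node l (.proc (.foreach (.conc I R) T ψ r P))) .err
  | for_ff {E : Net S} {l : S.Loc} {I : Interface S} {R : Data S} {T : Template S} {ψ : Pred S}
      {r : RowRel S} {P : Proc S} (hff : ¬ ∃ t₀ ∈ R, ψ.evalAt T t₀ = some true)
      (h : ¬ ForErr T ψ R) :
      Step Δ E (.node l (.proc (.foreach (.conc I R) T ψ r P))) (.node l (.proc .nil))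
  | seq_tt {E N N' : Net S} {l : S.Loc} {P₁ P₁' P₂ : Proc S} (hne : P₁' ≠ .nil)
      (h : Step Δ E (.par (.node l (.proc P₁)) N) (.par (.node l (.proc P₁')) N')) :
      Step Δ E (.par (.node l (.proc (.seq P₁ P₂))) N) (.par (.node l (.proc (.seq P₁' P₂))) N')
  | seq_ff {E N N' : Net S} {l : S.Loc} {P₁ P₂ : Proc S}
      (h : Step Δ E (.par (.node l (.proc P₁)) N) (.par (.node l (.proc .nil)) N')) :
      Step Δ E (.par (.node l (.proc (.seq P₁ P₂))) N) (.par (.node l (.proc P₂)) N')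
  | call {E : Net S} {l : S.Loc} {A : S.Pid} {es : List (Expr S)} {d : ProcDef S}
      {vs : List (Val S)} {σ : Subst S} (hd : Δ A = some d) (hvs : Tuple.eval es = some vs)
      (hσ : bindParams d.params vs = some σ) :
      Step Δ E (.node l (.proc (.call A es))) (.node l (.proc (d.body.subst σ)))
  | par {N₁ N₁' N₂ : Net S} (h : Step Δ N₂ N₁ N₁') :
      Step Δ .nil (.par N₁ N₂) (.par N₁' N₂)
  | res {E N N' : Net S} {l : S.Loc} (h : Step Δ E N N') :
      Step Δ E (.res l N) (.res l N')
  | equiv {E N₁ N₂ N₃ N₄ : Net S} (h₁₂ : Cong N₁ N₂) (h : Step Δ E N₂ N₃) (h₃₄ : Cong N₃ N₄) :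
      Step Δ E N₁ N₄

/-- `⊢ N →* N'`: any number of steps in the empty environment. -/
def Steps (Δ : Defs S) : Net S → Net S → Prop := Relation.ReflTransGen (Step Δ .nil)

end

/-! ## Type system -/

/-- Typing environments: partial maps from data variables to types and from table variables to
schemas, and the set of locality variables that are bound (to the type `Loc`). -/
structure TyEnv (S : Names) where
  dvar : S.DVar → Option MTy
  lvar : Set S.LVar
  tvar : S.TVar → Option Schema

section
variable {S : Names}

/-- `[]`. -/
def TyEnv.empty : TyEnv S := ⟨fun _ => none, ∅, fun _ => none⟩

/-- The extension `Γ, Γ'`; bindings in `Γ'` hide those in `Γ`. -/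
def TyEnv.ext (Γ Γ' : TyEnv S) : TyEnv S where
  dvar x := (Γ'.dvar x).or (Γ.dvar x)
  lvar := Γ'.lvar ∪ Γ.lvar
  tvar b := (Γ'.tvar b).or (Γ.tvar b)

open Classical in
/-- `[x : τ]`. -/
noncomputable def TyEnv.single (x : S.DVar) (τ : MTy) : TyEnv S :=
  { TyEnv.empty with dvar := fun y => if y = x then some τ else none }

/-- `[u : Loc]`. -/
def TyEnv.singleLoc (u : S.LVar) : TyEnv S := { TyEnv.empty with lvar := {u} }

open Classical in
/-- `[tbv : sk]`. -/
noncomputable def TyEnv.singleTab (tbv : S.TVar) (sk : Schema) : TyEnv S :=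
  { TyEnv.empty with tvar := fun b => if b = tbv then some sk else none }

/-- `Γ ⊢ e ▹ τ`. -/
inductive ExprTyped (Γ : TyEnv S) : Expr S → MTy → Prop
  | dvar {x : S.DVar} {τ : MTy} (h : Γ.dvar x = some τ) (hτ : τ ≠ .data .loc) :
      ExprTyped Γ (.dvar x) τ
  | lvar {u : S.LVar} (h : u ∈ Γ.lvar) : ExprTyped Γ (.lvar u) (.data .loc)
  | const {v : Val S} {τ : MTy} (h : v.HasSort τ) : ExprTyped Γ (.const v) τ
  | concat {e₁ e₂ : Expr S} (h₁ : ExprTyped Γ e₁ (.data .string))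
      (h₂ : ExprTyped Γ e₂ (.data .string)) : ExprTyped Γ (.concat e₁ e₂) (.data .string)
  | arith {op : AOp} {e₁ e₂ : Expr S} (h₁ : ExprTyped Γ e₁ (.data .int))
      (h₂ : ExprTyped Γ e₂ (.data .int)) : ExprTyped Γ (.arith op e₁ e₂) (.data .int)
  | mset {es : List (Expr S)} {τ : DTy} (h : ∀ e ∈ es, ExprTyped Γ e (.data τ)) :
      ExprTyped Γ (.mset es) (.mset τ)

/-- `Γ ⊢ ℓ ▹ Loc`. -/
def LExpTyped (Γ : TyEnv S) : LExp S → Prop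
  | .loc l => ExprTyped Γ (.const (.data (.loc l))) (.data .loc)
  | .var u => ExprTyped Γ (.lvar u) (.data .loc)

/-- `Γ ⊢ ψ ▹ Bool`. -/
inductive PredTyped (Γ : TyEnv S) : Pred S → Prop
  | tt : PredTyped Γ .tt
  | cmp {op : COp} {e₁ e₂ : Expr S} {τ : DTy} (h₁ : ExprTyped Γ e₁ (.data τ))
      (h₂ : ExprTyped Γ e₂ (.data τ)) : PredTyped Γ (.cmp op e₁ e₂)
  | mem {e₁ e₂ : Expr S} {τ : DTy} (h₁ : ExprTyped Γ e₁ (.data τ))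
      (h₂ : ExprTyped Γ e₂ (.mset τ)) : PredTyped Γ (.mem e₁ e₂)
  | neg {ψ : Pred S} (h : PredTyped Γ ψ) : PredTyped Γ (.neg ψ)
  | and {ψ₁ ψ₂ : Pred S} (h₁ : PredTyped Γ ψ₁) (h₂ : PredTyped Γ ψ₂) : PredTyped Γ (.and ψ₁ ψ₂)

/-- `Γ ⊢ t ▹ τ₁ × ... × τₙ`. -/
def TupleTyped (Γ : TyEnv S) (t : Tuple S) (sk : Schema) : Prop :=
  List.Forall₂ (ExprTyped Γ) t sk

/-- `τ ⊢ W ▹ Γ`. -/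
inductive FieldTyped : MTy → Field S → TyEnv S → Prop
  | dvar {τ : MTy} {x : S.DVar} (h : τ ≠ .data .loc) : FieldTyped τ (.dvar x) (.single x τ)
  | lvar {u : S.LVar} : FieldTyped (.data .loc) (.lvar u) (.singleLoc u)

inductive FieldsTyped : Schema → List (Field S) → TyEnv S → Prop
  | nil : FieldsTyped [] [] .empty
  | cons {τ : MTy} {τs : Schema} {W : Field S} {Ws : List (Field S)} {Γ₁ Γ₂ : TyEnv S}
      (h₁ : FieldTyped τ W Γ₁) (h₂ : FieldsTyped τs Ws Γ₂) :
      FieldsTyped (τ :: τs) (W :: Ws) (Γ₁.ext Γ₂)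

/-- `τ₁ × ... × τₙ ⊢ T ▹ Γ`. -/
def TemplateTyped (sk : Schema) (T : Template S) (Γ : TyEnv S) : Prop :=
  FieldsTyped sk T.fields Γ

/-- The rows of a concrete table all have the type `sk`. -/
def DataTyped (Γ : TyEnv S) (R : Data S) (sk : Schema) : Prop :=
  ∀ t ∈ R, TupleTyped Γ (t.map Expr.const) sk

/-- The assignment `∇` of schemas to table identifiers. -/
abbrev SchemaMap (S : Names) := S.Tid → Option Schema

/-- `Γ, ∇ ⊢ TB ▹ τ`. -/
inductive TableTyped (D : SchemaMap S) (Γ : TyEnv S) : Table S → Schema → Prop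
  | ref {tid : S.Tid} {ℓ : LExp S} {sk : Schema} (hℓ : LExpTyped Γ ℓ) (h : D tid = some sk) :
      TableTyped D Γ (.ref tid ℓ) sk
  | var {tbv : S.TVar} {sk : Schema} (h : Γ.tvar tbv = some sk) : TableTyped D Γ (.var tbv) sk
  | conc {I : Interface S} {R : Data S} (hR : DataTyped Γ R I.sk)
      (h : ∀ tid, I.tid = some tid → D tid = some I.sk) : TableTyped D Γ (.conc I R) I.sk

def Param.ty : Param S → MTy
  | .dvar _ τ => τ
  | .lvar _ => .data .loc

noncomputable def Param.env : Param S → TyEnv S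
  | .dvar x τ => .single x τ
  | .lvar u => .singleLoc u

/-- `[var₁ : τ₁, ..., varₙ : τₙ]`. -/
noncomputable def ProcDef.env (d : ProcDef S) : TyEnv S :=
  d.params.foldl (fun Γ p => Γ.ext p.env) .empty

mutual

/-- `Γ, ∇ ⊢ a ▹ Γ'`, where the procedures in `W` may be called. -/
inductive ActTyped (Δ : Defs S) (W : Set S.Pid) (D : SchemaMap S) :
    TyEnv S → Act S → TyEnv S → Prop
  | ins {Γ : TyEnv S} {tid : S.Tid} {t : Tuple S} {ℓ : LExp S} {sk : Schema}
      (hsk : D tid = some sk) (ht : TupleTyped Γ t sk) (hℓ : LExpTyped Γ ℓ) :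
      ActTyped Δ W D Γ (.ins tid t ℓ) .empty
  | del {Γ Γ' : TyEnv S} {tid : S.Tid} {T : Template S} {ψ : Pred S} {ℓ : LExp S} {sk : Schema}
      (hsk : D tid = some sk) (hT : TemplateTyped sk T Γ') (hψ : PredTyped (Γ.ext Γ') ψ)
      (hℓ : LExpTyped Γ ℓ) :
      ActTyped Δ W D Γ (.del tid T ψ ℓ) .empty
  | sel {Γ Γ' : TyEnv S} {TBs : List (Table S)} {T : Template S} {ψ : Pred S} {t : Tuple S}
      {tbv : S.TVar} {sks : List Schema} {sk' : Schema}
      (hTBs : List.Forall₂ (TableTyped D Γ) TBs sks) (hT : TemplateTyped sks.flatten T Γ')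
      (hψ : PredTyped (Γ.ext Γ') ψ) (ht : TupleTyped (Γ.ext Γ') t sk') :
      ActTyped Δ W D Γ (.sel TBs T ψ t tbv) (.singleTab tbv sk')
  | upd {Γ Γ' : TyEnv S} {tid : S.Tid} {T : Template S} {ψ : Pred S} {t : Tuple S} {ℓ : LExp S}
      {sk : Schema} (hsk : D tid = some sk) (hT : TemplateTyped sk T Γ')
      (hψ : PredTyped (Γ.ext Γ') ψ) (ht : TupleTyped (Γ.ext Γ') t sk) (hℓ : LExpTyped Γ ℓ) :
      ActTyped Δ W D Γ (.upd tid T ψ t ℓ) .empty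
  | aggr {Γ Γ' Γ'' : TyEnv S} {tid : S.Tid} {T T' : Template S} {ψ : Pred S} {f : Agg S}
      {ℓ : LExp S} (hsk : D tid = some f.dom) (hT : TemplateTyped f.dom T Γ')
      (hψ : PredTyped (Γ.ext Γ') ψ) (hT' : TemplateTyped f.cod T' Γ'') (hℓ : LExpTyped Γ ℓ) :
      ActTyped Δ W D Γ (.aggr tid T ψ f T' ℓ) Γ''
  | create {Γ : TyEnv S} {tid : S.Tid} {ℓ : LExp S} {sk : Schema}
      (hsk : D tid = some sk) (hℓ : LExpTyped Γ ℓ) :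
      ActTyped Δ W D Γ (.create tid ℓ sk) .empty
  | drop {Γ : TyEnv S} {tid : S.Tid} {ℓ : LExp S} (hℓ : LExpTyped Γ ℓ) :
      ActTyped Δ W D Γ (.drop tid ℓ) .empty
  | eval {Γ : TyEnv S} {P : Proc S} {ℓ : LExp S} (hP : ProcTyped Δ W D Γ P)
      (hℓ : LExpTyped Γ ℓ) :
      ActTyped Δ W D Γ (.eval P ℓ) .empty

/-- `Γ, ∇ ⊢ P`, where the procedures in `W` may be called. -/
inductive ProcTyped (Δ : Defs S) (W : Set S.Pid) (D : SchemaMap S) :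
    TyEnv S → Proc S → Prop
  | nil {Γ : TyEnv S} : ProcTyped Δ W D Γ .nil
  | pre {Γ Γ' : TyEnv S} {a : Act S} {P : Proc S} (ha : ActTyped Δ W D Γ a Γ')
      (hP : ProcTyped Δ W D (Γ.ext Γ') P) : ProcTyped Δ W D Γ (.pre a P)
  | seq {Γ : TyEnv S} {P₁ P₂ : Proc S} (h₁ : ProcTyped Δ W D Γ P₁)
      (h₂ : ProcTyped Δ W D Γ P₂) : ProcTyped Δ W D Γ (.seq P₁ P₂)
  | call {Γ : TyEnv S} {A : S.Pid} {es : List (Expr S)} {d : ProcDef S} (hd : Δ A = some d)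
      (hA : A ∈ W) (hes : TupleTyped Γ es (d.params.map Param.ty)) :
      ProcTyped Δ W D Γ (.call A es)
  | foreach {Γ Γ' : TyEnv S} {TB : Table S} {T : Template S} {ψ : Pred S} {r : RowRel S}
      {P : Proc S} {sk : Schema} (hTB : TableTyped D Γ TB sk) (hT : TemplateTyped sk T Γ')
      (hψ : PredTyped (Γ.ext Γ') ψ) (hP : ProcTyped Δ W D (Γ.ext Γ') P) :
      ProcTyped Δ W D Γ (.foreach TB T ψ r P)

end

inductive CompTyped (Δ : Defs S) (W : Set S.Pid) (D : SchemaMap S) (Γ : TyEnv S) :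
    Comp S → Prop
  | proc {P : Proc S} (h : ProcTyped Δ W D Γ P) : CompTyped Δ W D Γ (.proc P)
  | tab {I : Interface S} {R : Data S} {tid : S.Tid} (hR : DataTyped Γ R I.sk)
      (htid : I.tid = some tid) (h : D tid = some I.sk) : CompTyped Δ W D Γ (.tab I R)
  | par {C₁ C₂ : Comp S} (h₁ : CompTyped Δ W D Γ C₁) (h₂ : CompTyped Δ W D Γ C₂) :
      CompTyped Δ W D Γ (.par C₁ C₂)

inductive NetTyped (Δ : Defs S) (W : Set S.Pid) (D : SchemaMap S) (Γ : TyEnv S) :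
    Net S → Prop
  | nil : NetTyped Δ W D Γ .nil
  | node {l : S.Loc} {C : Comp S} (hl : LExpTyped Γ (.loc l)) (h : CompTyped Δ W D Γ C) :
      NetTyped Δ W D Γ (.node l C)
  | res {l : S.Loc} {N : Net S} (h : NetTyped Δ W D Γ N) : NetTyped Δ W D Γ (.res l N)
  | par {N₁ N₂ : Net S} (h₁ : NetTyped Δ W D Γ N₁) (h₂ : NetTyped Δ W D Γ N₂) :
      NetTyped Δ W D Γ (.par N₁ N₂)

/-- `Γ, ∇ ⊢ N`. A call is well typed if its arguments fit the parameters and the body of the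
procedure is well typed in the environment of the parameters. Procedures can be recursive, so this
is read coinductively: there is a set `W` of procedures whose bodies are well typed when the
procedures in `W` may be called, and `N` is well typed when the procedures in `W` may be called. -/
def WellTyped (Δ : Defs S) (D : SchemaMap S) (Γ : TyEnv S) (N : Net S) : Prop :=
  ∃ W : Set S.Pid,
    (∀ A ∈ W, ∀ d, Δ A = some d → ProcTyped Δ W D d.env d.body) ∧ NetTyped Δ W D Γ N

end

end KlaimDB

/-!
Soundness is proved by subject reduction, for an invariant that is weaker than the typing of nets.

Typing itself is not preserved by reduction. An empty multiset constant has every type `{τ}`, so the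
schema that `select` computes at run time for its result may differ from the type with which the
continuation was checked, and then the continuation with the resulting table substituted in it need
not be typed. What is preserved is `Net.Safe`. It types a concrete table `(I, R)` in a process by
any schema that all its rows have, as long as `I.sk` has the type `Loc` at the same places
(`Table.Safe`). This is enough, since at run time the schema of such a table is only compared with
templates, and `T ⊩ sk` depends only on where `sk` has the type `Loc`. The schema computed by
`select` stays within this relaxation (`SkProj.forall₂`). Tables located in the net still have
exactly the schema assigned to their identifier.

Safety implies the absence of `ERR`, and it is invariant under structural congruence
(`Cong.safe_iff`). The only case with content is α-equivalence: safety is equivariant under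
permutations of names (`Proc.safe_rename`) and depends only on the types of the free variables
(`Proc.Safe.of_agreeOn`), so a transposition of two names that are not free does not affect it.

Safety is preserved by reduction (`Step.safe`). Closed well-typed expressions, predicates and tuples
evaluate to constants of their types (`ExprTyped.exists_eval` and its companions), and rows of the
expected schema match a template with a substitution of the right type (`exists_match`); so no error
condition can hold. The continuations after matching, selection and procedure calls are
covered by the substitution lemma `Proc.Safe.subst`. Recursive procedures need no separate argument,
because the set `W` of callable procedures with well-typed bodies is fixed throughout.
-/

namespace KlaimDB

section
variable {S : Names}

/-! ### Typing environments -/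

theorem TyEnv.empty_ext (Γ : TyEnv S) : TyEnv.empty.ext Γ = Γ := by
  simp [TyEnv.ext, TyEnv.empty]

theorem TyEnv.ext_empty (Γ : TyEnv S) : Γ.ext TyEnv.empty = Γ := by
  simp [TyEnv.ext, TyEnv.empty]

theorem TyEnv.ext_assoc (Γ₁ Γ₂ Γ₃ : TyEnv S) : (Γ₁.ext Γ₂).ext Γ₃ = Γ₁.ext (Γ₂.ext Γ₃) := by
  simp [TyEnv.ext, Option.or_assoc, Set.union_assoc]

/-- The environment that assigns to a name what `Γ` assigns to its image under `ρ`. -/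
def TyEnv.comap (ρ : Ren S) (Γ : TyEnv S) : TyEnv S where
  dvar x := Γ.dvar (ρ.dvar x)
  lvar := ρ.lvar ⁻¹' Γ.lvar
  tvar b := Γ.tvar (ρ.tvar b)

@[simp] theorem TyEnv.comap_empty (ρ : Ren S) : TyEnv.empty.comap ρ = TyEnv.empty := by
  simp [TyEnv.comap, TyEnv.empty]

@[simp] theorem TyEnv.comap_ext (ρ : Ren S) (Γ Γ' : TyEnv S) :
    (Γ.ext Γ').comap ρ = (Γ.comap ρ).ext (Γ'.comap ρ) := by
  simp [TyEnv.comap, TyEnv.ext]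

@[simp] theorem TyEnv.comap_single (ρ : Ren S) (x : S.DVar) (τ : MTy) :
    (TyEnv.single (ρ.dvar x) τ).comap ρ = TyEnv.single x τ := by
  simp only [TyEnv.comap, TyEnv.single, TyEnv.empty, Set.preimage_empty]
  congr 1
  funext y
  classical exact if_congr ρ.dvar.injective.eq_iff rfl rfl

@[simp] theorem TyEnv.comap_singleLoc (ρ : Ren S) (u : S.LVar) :
    (TyEnv.singleLoc (ρ.lvar u)).comap ρ = TyEnv.singleLoc u := by
  simp [TyEnv.comap, TyEnv.singleLoc, TyEnv.empty, Set.ext_iff]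

@[simp] theorem TyEnv.comap_singleTab (ρ : Ren S) (b : S.TVar) (sk : Schema) :
    (TyEnv.singleTab (ρ.tvar b) sk).comap ρ = TyEnv.singleTab b sk := by
  simp only [TyEnv.comap, TyEnv.singleTab, TyEnv.empty, Set.preimage_empty]
  congr 1
  funext y
  classical exact if_congr ρ.tvar.injective.eq_iff rfl rfl

/-- The variables to which an environment assigns a type. -/
def TyEnv.dom (Γ : TyEnv S) : Set (Name S) := {n | match n with
  | .loc _ => False
  | .dvar x => Γ.dvar x ≠ none
  | .lvar u => u ∈ Γ.lvar
  | .tvar b => Γ.tvar b ≠ none}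

@[simp] theorem TyEnv.dom_empty : (TyEnv.empty : TyEnv S).dom = ∅ := by
  ext n; cases n <;> simp [TyEnv.dom, TyEnv.empty]

@[simp] theorem TyEnv.dom_ext (Γ Γ' : TyEnv S) : (Γ.ext Γ').dom = Γ.dom ∪ Γ'.dom := by
  ext n; cases n <;> simp [TyEnv.dom, TyEnv.ext] <;> tauto

@[simp] theorem TyEnv.dom_single (x : S.DVar) (τ : MTy) :
    (TyEnv.single x τ).dom = {.dvar x} := by
  ext n; cases n <;> simp [TyEnv.dom, TyEnv.single, TyEnv.empty]

@[simp] theorem TyEnv.dom_singleLoc (u : S.LVar) : (TyEnv.singleLoc u).dom = {.lvar u} := by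
  ext n; cases n <;> simp [TyEnv.dom, TyEnv.singleLoc, TyEnv.empty]

@[simp] theorem TyEnv.dom_singleTab (b : S.TVar) (sk : Schema) :
    (TyEnv.singleTab b sk).dom = {.tvar b} := by
  ext n; cases n <;> simp [TyEnv.dom, TyEnv.singleTab, TyEnv.empty]

/-- Two environments assign the same to the variables in `s`. -/
structure TyEnv.AgreeOn (Γ₁ Γ₂ : TyEnv S) (s : Set (Name S)) : Prop where
  dvar : ∀ x, Name.dvar x ∈ s → Γ₁.dvar x = Γ₂.dvar x
  lvar : ∀ u, Name.lvar u ∈ s → (u ∈ Γ₁.lvar ↔ u ∈ Γ₂.lvar)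
  tvar : ∀ b, Name.tvar b ∈ s → Γ₁.tvar b = Γ₂.tvar b

theorem TyEnv.AgreeOn.symm {Γ₁ Γ₂ : TyEnv S} {s : Set (Name S)} (h : Γ₁.AgreeOn Γ₂ s) :
    Γ₂.AgreeOn Γ₁ s :=
  ⟨fun x hx => (h.dvar x hx).symm, fun u hu => (h.lvar u hu).symm,
    fun b hb => (h.tvar b hb).symm⟩

theorem TyEnv.AgreeOn.mono {Γ₁ Γ₂ : TyEnv S} {s t : Set (Name S)} (h : Γ₁.AgreeOn Γ₂ s)
    (hts : t ⊆ s) : Γ₁.AgreeOn Γ₂ t :=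
  ⟨fun x hx => h.dvar x (hts hx), fun u hu => h.lvar u (hts hu), fun b hb => h.tvar b (hts hb)⟩

theorem TyEnv.AgreeOn.ext {Γ₁ Γ₂ : TyEnv S} {s : Set (Name S)} {Γ' : TyEnv S}
    (h : Γ₁.AgreeOn Γ₂ (s \ Γ'.dom)) : (Γ₁.ext Γ').AgreeOn (Γ₂.ext Γ') s where
  dvar x hx := by
    by_cases hd : Γ'.dvar x = none
    · simp [TyEnv.ext, hd, h.dvar x ⟨hx, by simp [TyEnv.dom, hd]⟩]
    · obtain ⟨τ, hτ⟩ := Option.ne_none_iff_exists'.1 hd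
      simp [TyEnv.ext, hτ]
  lvar u hu := by
    by_cases hd : u ∈ Γ'.lvar
    · simp [TyEnv.ext, hd]
    · simp [TyEnv.ext, hd, h.lvar u ⟨hu, by simp [TyEnv.dom, hd]⟩]
  tvar b hb := by
    by_cases hd : Γ'.tvar b = none
    · simp [TyEnv.ext, hd, h.tvar b ⟨hb, by simp [TyEnv.dom, hd]⟩]
    · obtain ⟨τ, hτ⟩ := Option.ne_none_iff_exists'.1 hd
      simp [TyEnv.ext, hτ]

/-- A transposition of names outside `s` does not affect what is assigned to the names in `s`. -/
theorem TyEnv.agreeOn_comap_swap (Γ : TyEnv S) {m n : Name S} {s : Set (Name S)} (hm : m ∉ s)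
    (hn : n ∉ s) : (Γ.comap (Ren.swap m n)).AgreeOn Γ s := by
  classical
  have key : ∀ {α : Type} (c : α → Name S) {a b x : α}, c a ∉ s → c b ∉ s → c x ∈ s →
      Equiv.swap a b x = x := fun c a b x ha hb hx =>
    Equiv.swap_apply_of_ne_of_ne (by rintro rfl; exact ha hx) (by rintro rfl; exact hb hx)
  constructor <;> intro x hx <;> cases m <;> cases n <;> simp only [TyEnv.comap, Ren.swap,
    Equiv.Perm.coe_one, id_eq, Set.mem_preimage]
  · exact congrArg Γ.dvar (by convert key Name.dvar hm hn hx)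
  · exact Eq.to_iff (congrArg (· ∈ Γ.lvar) (by convert key Name.lvar hm hn hx))
  · exact congrArg Γ.tvar (by convert key Name.tvar hm hn hx)

theorem TyEnv.comap_swap_of_notMem_dom (Γ : TyEnv S) {m n : Name S} (hm : m ∉ Γ.dom)
    (hn : n ∉ Γ.dom) : Γ.comap (Ren.swap m n) = Γ := by
  classical
  have key : ∀ {α β : Type} (g : α → β) {a b : α}, g a = g b →
      (fun x => g (Equiv.swap a b x)) = g := by
    intro α β g a b h
    funext x
    rw [Equiv.swap_apply_def]
    split_ifs <;> simp_all
  rcases m with a | a | a | a <;> rcases n with b | b | b | b <;>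
    simp only [TyEnv.comap, Ren.swap, Equiv.Perm.coe_one, id_eq, Set.preimage_id_eq]
  · congr 1; convert key Γ.dvar (a := a) (b := b) (by simp_all [TyEnv.dom])
  · have h : (a ∈ Γ.lvar) = (b ∈ Γ.lvar) := by simp_all [TyEnv.dom]
    congr 1; exact key (· ∈ Γ.lvar) h
  · congr 1; convert key Γ.tvar (a := a) (b := b) (by simp_all [TyEnv.dom])

theorem TyEnv.comap_swap_swap (Γ : TyEnv S) (m n : Name S) :
    (Γ.comap (Ren.swap m n)).comap (Ren.swap m n) = Γ := by
  cases m <;> cases n <;> simp [TyEnv.comap, Ren.swap, Set.preimage_preimage]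

/-! ### Environments of templates and actions -/

/-- The environment that gives the variable of a field the type `τ`. -/
noncomputable def Field.env : Field S → MTy → TyEnv S
  | .dvar x, τ => .single x τ
  | .lvar u, _ => .singleLoc u

/-- The environment that gives the variables of the fields the components of a schema; surplus fields
or components are ignored. -/
noncomputable def fieldsEnv : List (Field S) → Schema → TyEnv S
  | W :: Ws, τ :: τs => (W.env τ).ext (fieldsEnv Ws τs)
  | _, _ => .empty

/-- The environment that gives the variables of a template the components of a schema. -/
noncomputable def Template.env (T : Template S) (sk : Schema) : TyEnv S := fieldsEnv T.fields sk

theorem TemplateTyped.hasSort_and_eq {sk : Schema} {T : Template S} {Γ : TyEnv S}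
    (h : TemplateTyped sk T Γ) : T.HasSort sk ∧ Γ = T.env sk := by
  unfold Template.HasSort Template.env
  unfold TemplateTyped at h
  generalize T.fields = Ws at h ⊢
  induction h with
  | nil => exact ⟨.nil, rfl⟩
  | cons h₁ _ ih =>
    obtain ⟨ih₁, rfl⟩ := ih
    cases h₁ with
    | dvar hτ => exact ⟨.cons hτ ih₁, rfl⟩
    | lvar => exact ⟨.cons rfl ih₁, rfl⟩

theorem Template.hasSort_rename (ρ : Ren S) (T : Template S) (sk : Schema) :
    (T.rename ρ).HasSort sk ↔ T.HasSort sk := by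
  simp only [Template.HasSort, Template.rename, List.forall₂_map_left_iff]
  have h : ∀ (W : Field S) τ, (W.rename ρ).HasSort τ ↔ W.HasSort τ := by
    intro W τ; cases W <;> rfl
  simp only [h]

theorem fieldsEnv_rename (ρ : Ren S) (Ws : List (Field S)) (sk : Schema) :
    (fieldsEnv (Ws.map (Field.rename ρ)) sk).comap ρ = fieldsEnv Ws sk := by
  induction Ws generalizing sk with
  | nil => simp [fieldsEnv]
  | cons W Ws ih =>
    cases sk with
    | nil => simp [fieldsEnv]
    | cons τ τs => cases W <;> simp [fieldsEnv, Field.rename, Field.env, ih]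

theorem Template.env_rename (ρ : Ren S) (T : Template S) (sk : Schema) :
    ((T.rename ρ).env sk).comap ρ = T.env sk :=
  fieldsEnv_rename ρ T.fields sk

theorem dom_fieldsEnv {Ws : List (Field S)} {sk : Schema}
    (h : List.Forall₂ Field.HasSort Ws sk) :
    (fieldsEnv Ws sk).dom = {n | ∃ W ∈ Ws, n = W.name} := by
  induction h with
  | nil => simp [fieldsEnv]
  | @cons W τ _ _ _ _ ih =>
    ext n
    cases W <;> simp [fieldsEnv, ih, Field.env, Field.name]

theorem Template.HasSort.dom_env {T : Template S} {sk : Schema} (h : T.HasSort sk) :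
    (T.env sk).dom = T.bound :=
  dom_fieldsEnv h

/-- The environment in which the continuation of an action is typed; `k` is the schema of the
table that a `select` binds. -/
noncomputable def Act.env : Act S → Schema → TyEnv S
  | .sel _ _ _ _ tbv, k => .singleTab tbv k
  | .aggr _ _ _ f T' _, _ => T'.env f.cod
  | _, _ => .empty

theorem Act.env_rename (ρ : Ren S) (a : Act S) (k : Schema) :
    ((a.rename ρ).env k).comap ρ = a.env k := by
  cases a <;> simp [Act.rename, Act.env, Template.env_rename, Agg.rename]

/-! ### The invariant -/

/-- A relaxation of the typing of tables. A concrete table `(I, R)` has a schema `sk` if its rows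
have it and `I.sk` has the type `Loc` at the same places as `sk`. The schemas `I.sk` and `sk` need
not coincide, because an empty multiset in the tuple of a `select` has every type `{τ}`. -/
def Table.Safe (D : SchemaMap S) (Γ : TyEnv S) : Table S → Schema → Prop
  | .ref tid _, sk => D tid = some sk
  | .var tbv, sk => Γ.tvar tbv = some sk
  | .conc I R, sk => (∀ t ∈ R, RowHasSort t sk) ∧
      List.Forall₂ (fun τ τ' => τ = MTy.data .loc ↔ τ' = MTy.data .loc) I.sk sk

mutual

/-- A relaxation of the typing of actions; `k` is the schema of the table that a `select` binds.
It ignores localities and locality variables in addresses. -/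
noncomputable def Act.Safe (Δ : Defs S) (W : Set S.Pid) (D : SchemaMap S) :
    Act S → TyEnv S → Schema → Prop
  | .ins tid t _, Γ, _ => ∃ sk, D tid = some sk ∧ TupleTyped Γ t sk
  | .del tid T ψ _, Γ, _ =>
      ∃ sk, D tid = some sk ∧ T.HasSort sk ∧ PredTyped (Γ.ext (T.env sk)) ψ
  | .sel TBs T ψ t _, Γ, k => ∃ sks : List Schema, List.Forall₂ (Table.Safe D Γ) TBs sks ∧
      T.HasSort sks.flatten ∧ PredTyped (Γ.ext (T.env sks.flatten)) ψ ∧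
      TupleTyped (Γ.ext (T.env sks.flatten)) t k
  | .upd tid T ψ t _, Γ, _ => ∃ sk, D tid = some sk ∧ T.HasSort sk ∧
      PredTyped (Γ.ext (T.env sk)) ψ ∧ TupleTyped (Γ.ext (T.env sk)) t sk
  | .aggr tid T ψ f T' _, Γ, _ => D tid = some f.dom ∧ T.HasSort f.dom ∧
      PredTyped (Γ.ext (T.env f.dom)) ψ ∧ T'.HasSort f.cod
  | .create tid _ sk, _, _ => D tid = some sk
  | .drop _ _, _, _ => True
  | .eval P _, Γ, _ => Proc.Safe Δ W D P Γ

/-- A relaxation of the typing of processes, with the tables typed by `Table.Safe`. -/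
noncomputable def Proc.Safe (Δ : Defs S) (W : Set S.Pid) (D : SchemaMap S) :
    Proc S → TyEnv S → Prop
  | .nil, _ => True
  | .pre a P, Γ => ∃ k, Act.Safe Δ W D a Γ k ∧ Proc.Safe Δ W D P (Γ.ext (a.env k))
  | .call A es, Γ => A ∈ W ∧ ∃ d, Δ A = some d ∧ TupleTyped Γ es (d.params.map Param.ty)
  | .foreach TB T ψ _ P, Γ => ∃ sk, TB.Safe D Γ sk ∧ T.HasSort sk ∧
      PredTyped (Γ.ext (T.env sk)) ψ ∧ Proc.Safe Δ W D P (Γ.ext (T.env sk))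
  | .seq P₁ P₂, Γ => Proc.Safe Δ W D P₁ Γ ∧ Proc.Safe Δ W D P₂ Γ

end

/-- A located table is safe if its rows have its schema and its schema is the one assigned to its
identifier. -/
def TabSafe (D : SchemaMap S) (I : Interface S) (R : Data S) : Prop :=
  (∀ t ∈ R, RowHasSort t I.sk) ∧ ∃ tid, I.tid = some tid ∧ D tid = some I.sk

/-- A component is safe if its processes are safe in the empty environment and its tables are safe. -/
def Comp.Safe (Δ : Defs S) (W : Set S.Pid) (D : SchemaMap S) : Comp S → Prop
  | .proc P => P.Safe Δ W D .empty
  | .tab I R => TabSafe D I R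
  | .par C₁ C₂ => C₁.Safe Δ W D ∧ C₂.Safe Δ W D

/-- A net is safe if it does not contain `ERR` and its processes and tables are safe. -/
def Net.Safe (Δ : Defs S) (W : Set S.Pid) (D : SchemaMap S) : Net S → Prop
  | .nil => True
  | .err => False
  | .par N₁ N₂ => N₁.Safe Δ W D ∧ N₂.Safe Δ W D
  | .res _ N => N.Safe Δ W D
  | .node _ C => C.Safe Δ W D

variable {Δ : Defs S} {W : Set S.Pid} {D : SchemaMap S}

theorem tupleTyped_const_iff {Γ : TyEnv S} {t : Row S} {sk : Schema} :
    TupleTyped Γ (t.map Expr.const) sk ↔ RowHasSort t sk := by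
  simp only [TupleTyped, RowHasSort, List.forall₂_map_left_iff]
  have h : ∀ (v : Val S) τ, ExprTyped Γ (.const v) τ ↔ v.HasSort τ := fun v τ =>
    ⟨fun h => by cases h; assumption, .const⟩
  simp only [h]

theorem TableTyped.safe {Γ : TyEnv S} {TB : Table S} {sk : Schema} (h : TableTyped D Γ TB sk) :
    TB.Safe D Γ sk := by
  cases h with
  | ref _ h => exact h
  | var h => exact h
  | conc hR _ =>
    exact ⟨fun t ht => tupleTyped_const_iff.1 (hR t ht), List.forall₂_same.2 fun _ _ => Iff.rfl⟩

mutual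

theorem ActTyped.safe {Γ Γ' : TyEnv S} {a : Act S} (h : ActTyped Δ W D Γ a Γ') :
    ∃ k, a.Safe Δ W D Γ k ∧ Γ' = a.env k := by
  cases h with
  | ins hsk ht _ => exact ⟨[], by rw [Act.Safe]; exact ⟨_, hsk, ht⟩, rfl⟩
  | del hsk hT hψ _ =>
    obtain ⟨hs, rfl⟩ := hT.hasSort_and_eq
    exact ⟨[], by rw [Act.Safe]; exact ⟨_, hsk, hs, hψ⟩, rfl⟩
  | sel hTBs hT hψ ht =>
    obtain ⟨hs, rfl⟩ := hT.hasSort_and_eq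
    exact ⟨_, by rw [Act.Safe]; exact ⟨_, hTBs.imp fun _ _ h => h.safe, hs, hψ, ht⟩, rfl⟩
  | upd hsk hT hψ ht _ =>
    obtain ⟨hs, rfl⟩ := hT.hasSort_and_eq
    exact ⟨[], by rw [Act.Safe]; exact ⟨_, hsk, hs, hψ, ht⟩, rfl⟩
  | aggr hsk hT hψ hT' _ =>
    obtain ⟨hs, rfl⟩ := hT.hasSort_and_eq
    obtain ⟨hs', rfl⟩ := hT'.hasSort_and_eq
    exact ⟨[], by rw [Act.Safe]; exact ⟨hsk, hs, hψ, hs'⟩, rfl⟩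
  | create hsk _ => exact ⟨[], by rw [Act.Safe]; exact hsk, rfl⟩
  | drop _ => exact ⟨[], by rw [Act.Safe]; trivial, rfl⟩
  | eval hP _ => exact ⟨[], by rw [Act.Safe]; exact hP.safe, rfl⟩

theorem ProcTyped.safe {Γ : TyEnv S} {P : Proc S} (h : ProcTyped Δ W D Γ P) :
    P.Safe Δ W D Γ := by
  cases h with
  | nil => rw [Proc.Safe]; trivial
  | pre ha hP =>
    obtain ⟨k, hk, rfl⟩ := ha.safe
    rw [Proc.Safe]; exact ⟨k, hk, hP.safe⟩
  | seq h₁ h₂ => rw [Proc.Safe]; exact ⟨h₁.safe, h₂.safe⟩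
  | call hd hA hes => rw [Proc.Safe]; exact ⟨hA, _, hd, hes⟩
  | foreach hTB hT hψ hP =>
    obtain ⟨hs, rfl⟩ := hT.hasSort_and_eq
    rw [Proc.Safe]; exact ⟨_, hTB.safe, hs, hψ, hP.safe⟩

end

theorem CompTyped.safe {C : Comp S} (h : CompTyped Δ W D .empty C) : C.Safe Δ W D := by
  induction h with
  | proc h => exact h.safe
  | tab hR htid h => exact ⟨fun t ht => tupleTyped_const_iff.1 (hR t ht), _, htid, h⟩
  | par _ _ ih₁ ih₂ => exact ⟨ih₁, ih₂⟩

theorem NetTyped.safe {N : Net S} (h : NetTyped Δ W D .empty N) : N.Safe Δ W D := by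
  induction h with
  | nil => trivial
  | node _ h => exact h.safe
  | res _ ih => exact ih
  | par _ _ ih₁ ih₂ => exact ⟨ih₁, ih₂⟩

/-! ### Renaming of names -/

theorem exprTyped_rename (ρ : Ren S) {Γ : TyEnv S} {e : Expr S} {τ : MTy} :
    ExprTyped Γ (e.rename ρ) τ ↔ ExprTyped (Γ.comap ρ) e τ := by
  constructor
  · intro h
    generalize he : e.rename ρ = e' at h
    induction h generalizing e with
    | dvar h hτ => cases e <;> simp [Expr.rename] at he; subst he; exact .dvar h hτ
    | lvar h => cases e <;> simp [Expr.rename] at he; subst he; exact .lvar h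
    | const h =>
      cases e <;> simp [Expr.rename] at he; subst he
      exact .const ((Val.hasSort_rename _ _ _).1 h)
    | concat _ _ ih₁ ih₂ => cases e <;> simp [Expr.rename] at he; exact .concat (ih₁ he.1) (ih₂ he.2)
    | arith _ _ ih₁ ih₂ =>
      cases e <;> simp [Expr.rename] at he; exact .arith (ih₁ he.2.1) (ih₂ he.2.2)
    | mset h ih =>
      cases e <;> simp [Expr.rename] at he; subst he
      exact .mset fun e he => ih _ (List.mem_map.2 ⟨e, he, rfl⟩) rfl
  · intro h
    induction h with
    | dvar h hτ => rw [Expr.rename]; exact .dvar h hτ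
    | lvar h => rw [Expr.rename]; exact .lvar h
    | const h => rw [Expr.rename]; exact .const ((Val.hasSort_rename _ _ _).2 h)
    | concat _ _ ih₁ ih₂ => rw [Expr.rename]; exact .concat ih₁ ih₂
    | arith _ _ ih₁ ih₂ => rw [Expr.rename]; exact .arith ih₁ ih₂
    | mset h ih =>
      rw [Expr.rename]
      refine .mset fun e' he' => ?_
      obtain ⟨e, he, rfl⟩ := List.mem_map.1 he'
      exact ih e he

theorem tupleTyped_rename (ρ : Ren S) {Γ : TyEnv S} {t : Tuple S} {sk : Schema} :
    TupleTyped Γ (t.rename ρ) sk ↔ TupleTyped (Γ.comap ρ) t sk := by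
  simp only [TupleTyped, Tuple.rename, List.forall₂_map_left_iff, exprTyped_rename]

theorem predTyped_rename (ρ : Ren S) {Γ : TyEnv S} {ψ : Pred S} :
    PredTyped Γ (ψ.rename ρ) ↔ PredTyped (Γ.comap ρ) ψ := by
  induction ψ with
  | tt => exact ⟨fun _ => .tt, fun _ => .tt⟩
  | cmp op e₁ e₂ =>
    constructor
    · rintro (_ | ⟨h₁, h₂⟩); exact .cmp ((exprTyped_rename ρ).1 h₁) ((exprTyped_rename ρ).1 h₂)
    · rintro (_ | ⟨h₁, h₂⟩); exact .cmp ((exprTyped_rename ρ).2 h₁) ((exprTyped_rename ρ).2 h₂)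
  | mem e₁ e₂ =>
    constructor
    · rintro (_ | _ | ⟨h₁, h₂⟩); exact .mem ((exprTyped_rename ρ).1 h₁) ((exprTyped_rename ρ).1 h₂)
    · rintro (_ | _ | ⟨h₁, h₂⟩); exact .mem ((exprTyped_rename ρ).2 h₁) ((exprTyped_rename ρ).2 h₂)
  | neg ψ ih =>
    constructor
    · intro h; cases h with | neg h => exact .neg (ih.1 h)
    · intro h; cases h with | neg h => exact .neg (ih.2 h)
  | and ψ₁ ψ₂ ih₁ ih₂ =>
    constructor
    · intro h; cases h with | and h₁ h₂ => exact .and (ih₁.1 h₁) (ih₂.1 h₂)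
    · intro h; cases h with | and h₁ h₂ => exact .and (ih₁.2 h₁) (ih₂.2 h₂)

theorem forall_mem_rename {ρ : Ren S} {R : Data S} {sk : Schema} :
    (∀ t ∈ R.rename ρ, RowHasSort t sk) ↔ ∀ t ∈ R, RowHasSort t sk := by
  simp [Data.rename, rowHasSort_rename]

theorem Table.safe_rename (ρ : Ren S) {Γ : TyEnv S} {TB : Table S} {sk : Schema} :
    (TB.rename ρ).Safe D Γ sk ↔ TB.Safe D (Γ.comap ρ) sk := by
  cases TB
  · exact Iff.rfl
  · exact Iff.rfl
  · exact and_congr_left' forall_mem_rename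

mutual

theorem Act.safe_rename (ρ : Ren S) (a : Act S) (Γ : TyEnv S) (k : Schema) :
    (a.rename ρ).Safe Δ W D Γ k ↔ a.Safe Δ W D (Γ.comap ρ) k := by
  cases a with
  | eval P ℓ => simp only [Act.rename, Act.Safe]; exact P.safe_rename ρ Γ
  | _ =>
    simp [Act.rename, Act.Safe, tupleTyped_rename, predTyped_rename, Template.hasSort_rename,
      Template.env_rename, Table.safe_rename, List.forall₂_map_left_iff, Agg.rename]

theorem Proc.safe_rename (ρ : Ren S) (P : Proc S) (Γ : TyEnv S) :
    (P.rename ρ).Safe Δ W D Γ ↔ P.Safe Δ W D (Γ.comap ρ) := by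
  cases P with
  | nil => simp [Proc.rename, Proc.Safe]
  | pre a P =>
    simp only [Proc.rename, Proc.Safe, a.safe_rename ρ, P.safe_rename ρ, TyEnv.comap_ext,
      Act.env_rename]
  | call A es => simp only [Proc.rename, Proc.Safe, tupleTyped_rename]
  | foreach TB T ψ r P =>
    simp only [Proc.rename, Proc.Safe, P.safe_rename ρ, TyEnv.comap_ext, predTyped_rename,
      Template.hasSort_rename, Template.env_rename, Table.safe_rename]
  | seq P₁ P₂ => simp only [Proc.rename, Proc.Safe, P₁.safe_rename ρ, P₂.safe_rename ρ]

end

theorem Comp.safe_rename (ρ : Ren S) (C : Comp S) :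
    (C.rename ρ).Safe Δ W D ↔ C.Safe Δ W D := by
  induction C with
  | proc P => simp only [Comp.rename, Comp.Safe, P.safe_rename, TyEnv.comap_empty]
  | tab I R => exact and_congr_left' forall_mem_rename
  | par C₁ C₂ ih₁ ih₂ => exact and_congr ih₁ ih₂

theorem Net.safe_rename (ρ : Ren S) (N : Net S) : (N.rename ρ).Safe Δ W D ↔ N.Safe Δ W D := by
  induction N with
  | nil => exact Iff.rfl
  | err => exact Iff.rfl
  | par N₁ N₂ ih₁ ih₂ => exact and_congr ih₁ ih₂
  | res l N ih => exact ih
  | node l C => exact C.safe_rename ρ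

/-! ### Dependence of typing on the free variables -/

theorem Expr.free_subset_of_mem {es : List (Expr S)} {e : Expr S} (he : e ∈ es) :
    e.free ⊆ (Expr.mset es).free := by
  rw [Expr.free]
  induction es with
  | nil => cases he
  | cons e' es ih =>
    rcases List.mem_cons.1 he with rfl | he
    · exact Set.subset_union_left
    · exact (ih he).trans Set.subset_union_right

theorem ExprTyped.of_agreeOn {Γ₁ Γ₂ : TyEnv S} {e : Expr S} {τ : MTy} (h : ExprTyped Γ₁ e τ)
    (hΓ : Γ₁.AgreeOn Γ₂ e.free) : ExprTyped Γ₂ e τ := by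
  induction h with
  | dvar h hτ => exact .dvar (by rw [← h]; exact (hΓ.dvar _ (by simp [Expr.free])).symm) hτ
  | lvar h => exact .lvar ((hΓ.lvar _ (by simp [Expr.free])).1 h)
  | const h => exact .const h
  | concat _ _ ih₁ ih₂ =>
    rw [Expr.free] at hΓ
    exact .concat (ih₁ (hΓ.mono Set.subset_union_left)) (ih₂ (hΓ.mono Set.subset_union_right))
  | arith _ _ ih₁ ih₂ =>
    rw [Expr.free] at hΓ
    exact .arith (ih₁ (hΓ.mono Set.subset_union_left)) (ih₂ (hΓ.mono Set.subset_union_right))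
  | mset _ ih => exact .mset fun e he => ih e he (hΓ.mono (Expr.free_subset_of_mem he))

theorem TupleTyped.of_agreeOn {Γ₁ Γ₂ : TyEnv S} {t : Tuple S} {sk : Schema}
    (h : TupleTyped Γ₁ t sk) (hΓ : Γ₁.AgreeOn Γ₂ t.free) : TupleTyped Γ₂ t sk := by
  unfold TupleTyped at h ⊢
  rw [List.forall₂_iff_get] at h ⊢
  exact ⟨h.1, fun i h₁ h₂ =>
    (h.2 i h₁ h₂).of_agreeOn (hΓ.mono fun n hn => ⟨_, List.get_mem _ _, hn⟩)⟩

theorem PredTyped.of_agreeOn {Γ₁ Γ₂ : TyEnv S} {ψ : Pred S} (h : PredTyped Γ₁ ψ)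
    (hΓ : Γ₁.AgreeOn Γ₂ ψ.free) : PredTyped Γ₂ ψ := by
  induction h with
  | tt => exact .tt
  | cmp h₁ h₂ =>
    exact .cmp (h₁.of_agreeOn (hΓ.mono Set.subset_union_left))
      (h₂.of_agreeOn (hΓ.mono Set.subset_union_right))
  | mem h₁ h₂ =>
    exact .mem (h₁.of_agreeOn (hΓ.mono Set.subset_union_left))
      (h₂.of_agreeOn (hΓ.mono Set.subset_union_right))
  | neg _ ih => exact .neg (ih hΓ)
  | and _ _ ih₁ ih₂ =>
    exact .and (ih₁ (hΓ.mono Set.subset_union_left)) (ih₂ (hΓ.mono Set.subset_union_right))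

theorem Table.Safe.of_agreeOn {Γ₁ Γ₂ : TyEnv S} {TB : Table S} {sk : Schema}
    (h : TB.Safe D Γ₁ sk) (hΓ : Γ₁.AgreeOn Γ₂ TB.free) : TB.Safe D Γ₂ sk := by
  cases TB with
  | ref => exact h
  | var b => exact (hΓ.tvar b rfl).symm.trans h
  | conc => exact h

/-- Agreement under the binders of a template. -/
theorem TyEnv.AgreeOn.ext_template {Γ₁ Γ₂ : TyEnv S} {T : Template S} {sk : Schema}
    {s : Set (Name S)} (h : Γ₁.AgreeOn Γ₂ (s \ T.bound)) (hT : T.HasSort sk) :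
    (Γ₁.ext (T.env sk)).AgreeOn (Γ₂.ext (T.env sk)) s :=
  TyEnv.AgreeOn.ext (by rwa [hT.dom_env])

theorem Act.Safe.dom_env {a : Act S} {Γ : TyEnv S} {k : Schema} (h : a.Safe Δ W D Γ k) :
    (a.env k).dom = a.bound := by
  cases a <;> simp [Act.env, Act.bound]
  rw [Act.Safe] at h
  exact h.2.2.2.dom_env

mutual

theorem Act.Safe.of_agreeOn {a : Act S} {Γ₁ Γ₂ : TyEnv S} {k : Schema}
    (h : a.Safe Δ W D Γ₁ k) (hΓ : Γ₁.AgreeOn Γ₂ a.free) : a.Safe Δ W D Γ₂ k := by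
  cases a with
  | ins tid t ℓ =>
    rw [Act.Safe] at h ⊢
    rw [Act.free] at hΓ
    obtain ⟨sk, hsk, ht⟩ := h
    exact ⟨sk, hsk, ht.of_agreeOn (hΓ.mono Set.subset_union_left)⟩
  | del tid T ψ ℓ =>
    rw [Act.Safe] at h ⊢
    rw [Act.free] at hΓ
    obtain ⟨sk, hsk, hT, hψ⟩ := h
    exact ⟨sk, hsk, hT, hψ.of_agreeOn ((hΓ.mono Set.subset_union_left).ext_template hT)⟩
  | sel TBs T ψ t tbv =>
    rw [Act.Safe] at h ⊢
    rw [Act.free] at hΓ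
    obtain ⟨sks, hTBs, hT, hψ, ht⟩ := h
    have hΓ' := (hΓ.mono Set.subset_union_right).ext_template hT
    refine ⟨sks, ?_, hT, hψ.of_agreeOn (hΓ'.mono Set.subset_union_left),
      ht.of_agreeOn (hΓ'.mono Set.subset_union_right)⟩
    rw [List.forall₂_iff_get] at hTBs ⊢
    exact ⟨hTBs.1, fun i h₁ h₂ => (hTBs.2 i h₁ h₂).of_agreeOn
      (hΓ.mono fun n hn => .inl ⟨_, List.get_mem _ _, hn⟩)⟩
  | upd tid T ψ t ℓ =>
    rw [Act.Safe] at h ⊢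
    rw [Act.free] at hΓ
    obtain ⟨sk, hsk, hT, hψ, ht⟩ := h
    have hΓ' := (hΓ.mono Set.subset_union_left).ext_template hT
    exact ⟨sk, hsk, hT, hψ.of_agreeOn (hΓ'.mono Set.subset_union_left),
      ht.of_agreeOn (hΓ'.mono Set.subset_union_right)⟩
  | aggr tid T ψ f T' ℓ =>
    rw [Act.Safe] at h ⊢
    rw [Act.free] at hΓ
    obtain ⟨hsk, hT, hψ, hT'⟩ := h
    exact ⟨hsk, hT, hψ.of_agreeOn ((hΓ.mono fun n hn => .inl (.inl hn)).ext_template hT), hT'⟩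
  | create tid ℓ sk => rw [Act.Safe] at h ⊢; exact h
  | drop tid ℓ => rw [Act.Safe]; trivial
  | eval P ℓ =>
    rw [Act.Safe] at h ⊢
    rw [Act.free] at hΓ
    exact Proc.Safe.of_agreeOn h (hΓ.mono Set.subset_union_left)

theorem Proc.Safe.of_agreeOn {P : Proc S} {Γ₁ Γ₂ : TyEnv S} (h : P.Safe Δ W D Γ₁)
    (hΓ : Γ₁.AgreeOn Γ₂ P.free) : P.Safe Δ W D Γ₂ := by
  cases P with
  | nil => rw [Proc.Safe]; trivial
  | pre a P =>
    rw [Proc.Safe] at h ⊢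
    rw [Proc.free] at hΓ
    obtain ⟨k, ha, hP⟩ := h
    exact ⟨k, Act.Safe.of_agreeOn ha (hΓ.mono Set.subset_union_left), Proc.Safe.of_agreeOn hP
      (TyEnv.AgreeOn.ext (by rw [ha.dom_env]; exact hΓ.mono Set.subset_union_right))⟩
  | call A es =>
    rw [Proc.Safe] at h ⊢
    rw [Proc.free] at hΓ
    obtain ⟨hA, d, hd, hes⟩ := h
    exact ⟨hA, d, hd, hes.of_agreeOn hΓ⟩
  | foreach TB T ψ r P =>
    rw [Proc.Safe] at h ⊢
    rw [Proc.free] at hΓ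
    obtain ⟨sk, hTB, hT, hψ, hP⟩ := h
    have hΓ' := (hΓ.mono Set.subset_union_right).ext_template hT
    exact ⟨sk, hTB.of_agreeOn (hΓ.mono fun n hn => .inl (.inl hn)), hT,
      hψ.of_agreeOn (hΓ'.mono Set.subset_union_left),
      Proc.Safe.of_agreeOn hP (hΓ'.mono Set.subset_union_right)⟩
  | seq P₁ P₂ =>
    rw [Proc.Safe] at h ⊢
    rw [Proc.free] at hΓ
    exact ⟨Proc.Safe.of_agreeOn h.1 (hΓ.mono Set.subset_union_left),
      Proc.Safe.of_agreeOn h.2 (hΓ.mono Set.subset_union_right)⟩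

end

/-! ### Invariance under structural congruence -/

theorem Proc.safe_swap {P : Proc S} {m n : Name S} (hm : m ∉ P.free) (hn : n ∉ P.free)
    (Γ : TyEnv S) : P.Safe Δ W D Γ ↔ (P.rename (Ren.swap m n)).Safe Δ W D Γ := by
  rw [Proc.safe_rename]
  have := Γ.agreeOn_comap_swap hm hn
  exact ⟨fun h => h.of_agreeOn this.symm, fun h => h.of_agreeOn this⟩

theorem Act.safe_swap {a : Act S} {m n : Name S} (hm : m ∉ a.free) (hn : n ∉ a.free)
    (Γ : TyEnv S) (k : Schema) :
    a.Safe Δ W D Γ k ↔ (a.rename (Ren.swap m n)).Safe Δ W D Γ k := by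
  rw [Act.safe_rename]
  have := Γ.agreeOn_comap_swap hm hn
  exact ⟨fun h => h.of_agreeOn this.symm, fun h => h.of_agreeOn this⟩

theorem Act.Safe.env_swap {a : Act S} {Γ : TyEnv S} {k : Schema} (h : a.Safe Δ W D Γ k)
    {m n : Name S} (hm : m ∉ a.bound) (hn : n ∉ a.bound) :
    a.env k = (a.rename (Ren.swap m n)).env k := by
  rw [← TyEnv.comap_swap_swap ((a.rename _).env k) m n, Act.env_rename,
    TyEnv.comap_swap_of_notMem_dom _ (h.dom_env ▸ hm) (h.dom_env ▸ hn)]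

/-- α-equivalent processes are safe in the same environments. For actions the induction also needs
that α-equivalent actions bind the same variables with the same types. -/
theorem AlphaProc.safe_iff {P Q : Proc S} (h : AlphaProc P Q) (Γ : TyEnv S) :
    P.Safe Δ W D Γ ↔ Q.Safe Δ W D Γ := by
  refine AlphaProc.rec
    (motive_1 := fun a b _ => ∀ k, (∀ Γ, a.Safe Δ W D Γ k ↔ b.Safe Δ W D Γ k) ∧
      ∀ Γ, a.Safe Δ W D Γ k → a.env k = b.env k)
    (motive_2 := fun P Q _ => ∀ Γ, P.Safe Δ W D Γ ↔ Q.Safe Δ W D Γ)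
    ?_ ?_ ?_ ?_ ?_ ?_ ?_ ?_ ?_ ?_ ?_ ?_ h Γ
  · exact fun _ _ => ⟨fun _ => Iff.rfl, fun _ _ => rfl⟩
  · exact fun _ ih k => ⟨fun Γ => ((ih k).1 Γ).symm,
      fun Γ hΓ => ((ih k).2 Γ (((ih k).1 Γ).2 hΓ)).symm⟩
  · exact fun _ _ ih₁ ih₂ k => ⟨fun Γ => ((ih₁ k).1 Γ).trans ((ih₂ k).1 Γ),
      fun Γ hΓ => ((ih₁ k).2 Γ hΓ).trans ((ih₂ k).2 Γ (((ih₁ k).1 Γ).1 hΓ))⟩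
  · intro a m n hm hn k
    simp only [Set.mem_union, not_or] at hm hn
    exact ⟨fun Γ => a.safe_swap hm.1 hn.1 Γ k, fun Γ hΓ => hΓ.env_swap hm.2 hn.2⟩
  · intro P P' ℓ _ ih k
    simp only [Act.Safe]
    exact ⟨ih, fun _ _ => rfl⟩
  · exact fun _ _ => Iff.rfl
  · exact fun _ ih Γ => (ih Γ).symm
  · exact fun _ _ ih₁ ih₂ Γ => (ih₁ Γ).trans (ih₂ Γ)
  · exact fun P m n hm hn Γ => P.safe_swap hm hn Γ
  · intro a a' P P' _ _ iha ihP Γ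
    rw [Proc.Safe, Proc.Safe]
    refine exists_congr fun k => ?_
    rw [← (iha k).1 Γ]
    refine and_congr_right fun ha => ?_
    rw [← (iha k).2 Γ ha]
    exact ihP _
  · intro TB T ψ r P P' _ ih Γ
    rw [Proc.Safe, Proc.Safe]
    exact exists_congr fun sk => and_congr_right' (and_congr_right' (and_congr_right' (ih _)))
  · intro P₁ P₁' P₂ P₂' _ _ ih₁ ih₂ Γ
    rw [Proc.Safe, Proc.Safe]
    exact and_congr (ih₁ Γ) (ih₂ Γ)

theorem AlphaComp.safe_iff {C C' : Comp S} (h : AlphaComp C C') :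
    C.Safe Δ W D ↔ C'.Safe Δ W D := by
  induction h with
  | refl => exact Iff.rfl
  | proc h => exact h.safe_iff _
  | par _ _ ih₁ ih₂ => exact and_congr ih₁ ih₂

theorem AlphaNet.safe_iff {N N' : Net S} (h : AlphaNet N N') :
    N.Safe Δ W D ↔ N'.Safe Δ W D := by
  induction h with
  | refl => exact Iff.rfl
  | symm _ ih => exact ih.symm
  | trans _ _ ih₁ ih₂ => exact ih₁.trans ih₂
  | swap N m n _ _ => exact (N.safe_rename _).symm
  | par _ _ ih₁ ih₂ => exact and_congr ih₁ ih₂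
  | res _ _ ih => exact ih
  | node _ h => exact h.safe_iff

theorem Cong.safe_iff {N N' : Net S} (h : Cong N N') : N.Safe Δ W D ↔ N'.Safe Δ W D := by
  induction h with
  | refl => exact Iff.rfl
  | symm _ ih => exact ih.symm
  | trans _ _ ih₁ ih₂ => exact ih₁.trans ih₂
  | par _ _ ih₁ ih₂ => exact and_congr ih₁ ih₂
  | res _ _ ih => exact ih
  | par_comm => exact and_comm
  | par_assoc => exact and_assoc
  | par_nil => exact and_iff_left trivial
  | res_comm => exact Iff.rfl
  | extrude => exact Iff.rfl
  | alpha h => exact h.safe_iff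
  | split => exact Iff.rfl
  | proc_nil => exact and_iff_left (by rw [Comp.Safe, Proc.Safe]; trivial)

theorem Net.Safe.ok {N : Net S} (h : N.Safe Δ W D) : Ok N :=
  fun ⟨_, hc⟩ => (hc.safe_iff.1 h).2

/-! ### Substitution -/

/-- The substitution `σ` takes phrases typed in `Γ` to phrases typed in `Γ'`: what it substitutes
for a variable fits the type in `Γ`, and the variables it leaves alone have the same type in `Γ'`. -/
structure SubstTyped (D : SchemaMap S) (σ : Subst S) (Γ Γ' : TyEnv S) : Prop where
  dvar : ∀ x τ, Γ.dvar x = some τ → (σ.dvar x).elim (Γ'.dvar x = some τ) (·.HasSort τ)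
  lvar : ∀ u ∈ Γ.lvar, σ.lvar u = none → u ∈ Γ'.lvar
  tvar : ∀ b sk, Γ.tvar b = some sk →
    (σ.tvar b).elim (Γ'.tvar b = some sk) fun p => (Table.conc p.1 p.2).Safe D .empty sk

theorem SubstTyped.under {σ : Subst S} {Γ Γ' Γ'' : TyEnv S} (h : SubstTyped D σ Γ Γ')
    {B : Set (Name S)} (hB : Γ''.dom = B) :
    SubstTyped D (σ.under B) (Γ.ext Γ'') (Γ'.ext Γ'') where
  dvar x τ hx := by
    by_cases hd : Γ''.dvar x = none
    · simp only [TyEnv.ext, hd, Option.none_or] at hx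
      simpa [Subst.under, ← hB, TyEnv.dom, hd, TyEnv.ext] using h.dvar x τ hx
    · simpa [Subst.under, ← hB, TyEnv.dom, hd, TyEnv.ext] using hx
  lvar u hu hσ := by
    by_cases hd : u ∈ Γ''.lvar
    · exact .inl hd
    · exact .inr (h.lvar u (hu.resolve_left hd)
        (by simpa [Subst.under, ← hB, TyEnv.dom, hd] using hσ))
  tvar b sk hb := by
    by_cases hd : Γ''.tvar b = none
    · simp only [TyEnv.ext, hd, Option.none_or] at hb
      simpa [Subst.under, ← hB, TyEnv.dom, hd, TyEnv.ext] using h.tvar b sk hb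
    · simpa [Subst.under, ← hB, TyEnv.dom, hd, TyEnv.ext] using hb

theorem SubstTyped.under_template {σ : Subst S} {Γ Γ' : TyEnv S} (h : SubstTyped D σ Γ Γ')
    {T : Template S} {sk : Schema} (hT : T.HasSort sk) :
    SubstTyped D (σ.under T.bound) (Γ.ext (T.env sk)) (Γ'.ext (T.env sk)) :=
  h.under hT.dom_env

theorem ExprTyped.subst {σ : Subst S} {Γ Γ' : TyEnv S} {e : Expr S} {τ : MTy}
    (h : ExprTyped Γ e τ) (hσ : SubstTyped D σ Γ Γ') : ExprTyped Γ' (e.subst σ) τ := by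
  induction h with
  | @dvar x τ h hτ =>
    have := hσ.dvar x τ h
    rw [Expr.subst]
    cases hx : σ.dvar x with
    | none => rw [hx] at this; exact .dvar this hτ
    | some v => rw [hx] at this; exact .const this
  | @lvar u h =>
    rw [Expr.subst]
    cases hu : σ.lvar u with
    | none => exact .lvar (hσ.lvar u h hu)
    | some l => exact .const rfl
  | const h => rw [Expr.subst]; exact .const h
  | concat _ _ ih₁ ih₂ => rw [Expr.subst]; exact .concat ih₁ ih₂
  | arith _ _ ih₁ ih₂ => rw [Expr.subst]; exact .arith ih₁ ih₂
  | mset _ ih =>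
    rw [Expr.subst]
    refine .mset fun e' he' => ?_
    obtain ⟨e, he, rfl⟩ := List.mem_map.1 he'
    exact ih e he

theorem TupleTyped.subst {σ : Subst S} {Γ Γ' : TyEnv S} {t : Tuple S} {sk : Schema}
    (h : TupleTyped Γ t sk) (hσ : SubstTyped D σ Γ Γ') : TupleTyped Γ' (t.subst σ) sk := by
  unfold TupleTyped Tuple.subst at *
  rw [List.forall₂_map_left_iff]
  exact h.imp fun _ _ h => h.subst hσ

theorem PredTyped.subst {σ : Subst S} {Γ Γ' : TyEnv S} {ψ : Pred S} (h : PredTyped Γ ψ)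
    (hσ : SubstTyped D σ Γ Γ') : PredTyped Γ' (ψ.subst σ) := by
  induction h with
  | tt => exact .tt
  | cmp h₁ h₂ => exact .cmp (h₁.subst hσ) (h₂.subst hσ)
  | mem h₁ h₂ => exact .mem (h₁.subst hσ) (h₂.subst hσ)
  | neg _ ih => exact .neg ih
  | and _ _ ih₁ ih₂ => exact .and ih₁ ih₂

theorem Table.Safe.subst {σ : Subst S} {Γ Γ' : TyEnv S} {TB : Table S} {sk : Schema}
    (h : TB.Safe D Γ sk) (hσ : SubstTyped D σ Γ Γ') : (TB.subst σ).Safe D Γ' sk := by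
  cases TB with
  | ref => exact h
  | var b =>
    have := hσ.tvar b sk h
    rw [Table.subst]
    cases hb : σ.tvar b with
    | none => rw [hb] at this; exact this
    | some p => rw [hb] at this; exact this
  | conc => exact h

theorem Act.env_subst (σ : Subst S) (a : Act S) (k : Schema) : (a.subst σ).env k = a.env k := by
  cases a <;> simp only [Act.subst, Act.env]

mutual

theorem Act.Safe.subst {a : Act S} {σ : Subst S} {Γ Γ' : TyEnv S} {k : Schema}
    (h : a.Safe Δ W D Γ k) (hσ : SubstTyped D σ Γ Γ') : (a.subst σ).Safe Δ W D Γ' k := by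
  cases a with
  | ins tid t ℓ =>
    rw [Act.Safe] at h
    rw [Act.subst, Act.Safe]
    obtain ⟨sk, hsk, ht⟩ := h
    exact ⟨sk, hsk, ht.subst hσ⟩
  | del tid T ψ ℓ =>
    rw [Act.Safe] at h
    rw [Act.subst, Act.Safe]
    obtain ⟨sk, hsk, hT, hψ⟩ := h
    exact ⟨sk, hsk, hT, hψ.subst (hσ.under_template hT)⟩
  | sel TBs T ψ t tbv =>
    rw [Act.Safe] at h
    rw [Act.subst, Act.Safe]
    obtain ⟨sks, hTBs, hT, hψ, ht⟩ := h
    refine ⟨sks, ?_, hT, hψ.subst (hσ.under_template hT), ht.subst (hσ.under_template hT)⟩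
    rw [List.forall₂_map_left_iff]
    exact hTBs.imp fun _ _ h => h.subst hσ
  | upd tid T ψ t ℓ =>
    rw [Act.Safe] at h
    rw [Act.subst, Act.Safe]
    obtain ⟨sk, hsk, hT, hψ, ht⟩ := h
    exact ⟨sk, hsk, hT, hψ.subst (hσ.under_template hT), ht.subst (hσ.under_template hT)⟩
  | aggr tid T ψ f T' ℓ =>
    rw [Act.Safe] at h
    rw [Act.subst, Act.Safe]
    obtain ⟨hsk, hT, hψ, hT'⟩ := h
    exact ⟨hsk, hT, hψ.subst (hσ.under_template hT), hT'⟩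
  | create tid ℓ sk =>
    rw [Act.Safe] at h
    rw [Act.subst, Act.Safe]
    exact h
  | drop tid ℓ => rw [Act.subst, Act.Safe]; trivial
  | eval P ℓ =>
    rw [Act.Safe] at h
    rw [Act.subst, Act.Safe]
    exact Proc.Safe.subst h hσ

theorem Proc.Safe.subst {P : Proc S} {σ : Subst S} {Γ Γ' : TyEnv S} (h : P.Safe Δ W D Γ)
    (hσ : SubstTyped D σ Γ Γ') : (P.subst σ).Safe Δ W D Γ' := by
  cases P with
  | nil => rw [Proc.subst, Proc.Safe]; trivial
  | pre a P =>
    rw [Proc.Safe] at h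
    rw [Proc.subst, Proc.Safe]
    obtain ⟨k, ha, hP⟩ := h
    refine ⟨k, Act.Safe.subst ha hσ, ?_⟩
    rw [Act.env_subst]
    exact Proc.Safe.subst hP (hσ.under ha.dom_env)
  | call A es =>
    rw [Proc.Safe] at h
    rw [Proc.subst, Proc.Safe]
    obtain ⟨hA, d, hd, hes⟩ := h
    exact ⟨hA, d, hd, hes.subst hσ⟩
  | foreach TB T ψ r P =>
    rw [Proc.Safe] at h
    rw [Proc.subst, Proc.Safe]
    obtain ⟨sk, hTB, hT, hψ, hP⟩ := h
    exact ⟨sk, hTB.subst hσ, hT, hψ.subst (hσ.under_template hT),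
      Proc.Safe.subst hP (hσ.under_template hT)⟩
  | seq P₁ P₂ =>
    rw [Proc.Safe] at h
    rw [Proc.subst, Proc.Safe]
    exact ⟨Proc.Safe.subst h.1 hσ, Proc.Safe.subst h.2 hσ⟩

end

theorem SubstTyped.empty : SubstTyped D (Subst.empty : Subst S) .empty .empty :=
  ⟨fun _ _ h => by simp [TyEnv.empty] at h, fun _ h => h.elim,
    fun _ _ h => by simp [TyEnv.empty] at h⟩

/-- In `Subst.append` the first binding of a variable counts and in `TyEnv.ext` the last one, so the
variable must not be bound twice. -/
theorem SubstTyped.single_append {σ : Subst S} {Γ : TyEnv S} (h : SubstTyped D σ Γ .empty)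
    {x : S.DVar} (hx : Name.dvar x ∉ Γ.dom) {v : Val S} {τ : MTy} (hv : v.HasSort τ) :
    SubstTyped D ((Subst.single x v).append σ) ((TyEnv.single x τ).ext Γ) .empty where
  dvar y τ' hy := by
    by_cases hyx : y = x
    · subst hyx
      have : Γ.dvar y = none := by simpa [TyEnv.dom] using hx
      simp only [TyEnv.ext, this, TyEnv.single, if_true, Option.none_or, Option.some.injEq] at hy
      subst hy
      simpa [Subst.append, Subst.single] using hv
    · have : Γ.dvar y = some τ' := by simpa [TyEnv.ext, TyEnv.single, hyx] using hy
      simpa [Subst.append, Subst.single, hyx] using h.dvar y τ' this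
  lvar u hu hσ := h.lvar u (by simpa [TyEnv.ext, TyEnv.single, TyEnv.empty] using hu)
    (by simpa [Subst.append, Subst.single, Subst.empty] using hσ)
  tvar b sk hb := by
    simpa [Subst.append, Subst.single, Subst.empty] using
      h.tvar b sk (by simpa [TyEnv.ext, TyEnv.single, TyEnv.empty] using hb)

theorem SubstTyped.singleLoc_append {σ : Subst S} {Γ : TyEnv S} (h : SubstTyped D σ Γ .empty)
    (u : S.LVar) (l : S.Loc) :
    SubstTyped D ((Subst.singleLoc u l).append σ) ((TyEnv.singleLoc u).ext Γ) .empty where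
  dvar x τ hx := by
    simpa [Subst.append, Subst.singleLoc, Subst.empty] using
      h.dvar x τ (by simpa [TyEnv.ext, TyEnv.singleLoc, TyEnv.empty] using hx)
  lvar w hw hσ := by
    by_cases hwu : w = u
    · simp [Subst.append, Subst.singleLoc, hwu] at hσ
    · exact h.lvar w (by simpa [TyEnv.ext, TyEnv.singleLoc, hwu] using hw)
        (by simpa [Subst.append, Subst.singleLoc, hwu] using hσ)
  tvar b sk hb := by
    simpa [Subst.append, Subst.singleLoc, Subst.empty] using
      h.tvar b sk (by simpa [TyEnv.ext, TyEnv.singleLoc, TyEnv.empty] using hb)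

theorem SubstTyped.singleTab {I : Interface S} {R : Data S} {sk : Schema}
    (h : (Table.conc I R).Safe D .empty sk) (b : S.TVar) :
    SubstTyped D (Subst.singleTab b I R) (.singleTab b sk) .empty where
  dvar x τ hx := by simp [TyEnv.singleTab, TyEnv.empty] at hx
  lvar u hu := by simp [TyEnv.singleTab, TyEnv.empty] at hu
  tvar c sk' hc := by
    by_cases hcb : c = b
    · have : sk = sk' := by simpa [TyEnv.singleTab, hcb] using hc
      subst this
      simpa [Subst.singleTab, hcb] using h
    · simp [TyEnv.singleTab, hcb] at hc

/-! ### Matching -/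

theorem Val.HasSort.exists_loc {v : Val S} (h : v.HasSort (.data .loc)) :
    ∃ l, v = .data (.loc l) := by
  rcases v with (_ | _ | _ | l) | m <;> simp [Val.HasSort, DVal.ty] at h ⊢

/-- Rows of a schema match the fields of a linear template of that schema. -/
theorem exists_matchFields {Ws : List (Field S)} {t : Row S} {sk : Schema}
    (hW : List.Forall₂ Field.HasSort Ws sk) (ht : RowHasSort t sk) (hnd : Ws.Nodup) :
    ∃ σ, matchFields Ws t = some σ ∧ SubstTyped D σ (fieldsEnv Ws sk) .empty := by
  induction hW generalizing t with
  | nil =>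
    cases ht
    exact ⟨_, by rw [matchFields], .empty⟩
  | @cons F τ Ws sk hF hWs ih =>
    rcases ht with _ | ⟨hv, ht⟩
    rename_i v t
    obtain ⟨hF', hnd⟩ := List.nodup_cons.1 hnd
    obtain ⟨σ, hσ, hσt⟩ := ih ht hnd
    have hF'' : F.name ∉ (fieldsEnv Ws sk).dom := by
      rw [dom_fieldsEnv hWs]
      rintro ⟨F', hmem, heq⟩
      have : F = F' := by cases F <;> cases F' <;> simp_all [Field.name]
      exact hF' (this ▸ hmem)
    cases F with
    | dvar x =>
      have hp : v.Proper := ⟨τ, hv⟩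
      have hm : (Field.dvar x).match v = some (Subst.single x v) := by
        cases v with
        | mset m => simp [Field.match, hp]
        | data d =>
          cases d with
          | loc l =>
            cases τ with
            | data τ => exact absurd (congrArg MTy.data (show DTy.loc = τ from hv)).symm hF
            | mset τ => exact hv.elim
          | _ => simp [Field.match, hp]
      exact ⟨_, by rw [matchFields, hm, hσ], hσt.single_append hF'' hv⟩
    | lvar u =>
      obtain rfl : τ = .data .loc := hF
      obtain ⟨l, rfl⟩ := hv.exists_loc
      exact ⟨_, by rw [matchFields, Field.match, hσ], hσt.singleLoc_append u l⟩

theorem exists_match {T : Template S} {t : Row S} {sk : Schema} (hT : T.HasSort sk)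
    (ht : RowHasSort t sk) : ∃ σ, T.match t = some σ ∧ SubstTyped D σ (T.env sk) .empty :=
  exists_matchFields hT ht T.linear

theorem SubstTyped.of_match {T : Template S} {t : Row S} {sk : Schema} {σ : Subst S}
    (hT : T.HasSort sk) (ht : RowHasSort t sk) (hσ : T.match t = some σ) :
    SubstTyped D σ (T.env sk) .empty := by
  obtain ⟨σ', hσ', h⟩ := exists_match (D := D) hT ht
  rw [hσ] at hσ'
  cases hσ'
  exact h

/-- The environment of a list of parameters. -/
noncomputable def paramsEnv (ps : List (Param S)) : TyEnv S :=
  ps.foldl (fun Γ p => Γ.ext p.env) .empty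

/-- `paramsEnv` is a left fold and `bindParams` recurses on the right; extension of environments is
associative. -/
theorem paramsEnv_cons (p : Param S) (ps : List (Param S)) :
    paramsEnv (p :: ps) = p.env.ext (paramsEnv ps) := by
  have h : ∀ (ps : List (Param S)) (Γ : TyEnv S),
      ps.foldl (fun Γ p => Γ.ext p.env) Γ = Γ.ext (paramsEnv ps) := by
    intro ps
    induction ps with
    | nil => exact fun Γ => Γ.ext_empty.symm
    | cons p ps ih =>
      intro Γ
      rw [paramsEnv, List.foldl_cons, List.foldl_cons, ih, ih, TyEnv.empty_ext, TyEnv.ext_assoc]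
  rw [paramsEnv, List.foldl_cons, h, TyEnv.empty_ext]

theorem dom_paramsEnv (ps : List (Param S)) :
    (paramsEnv ps).dom = {n | n ∈ ps.map Param.name} := by
  induction ps with
  | nil => simp [paramsEnv]
  | cons p ps ih =>
    ext n
    cases p <;> simp [paramsEnv_cons, ih, Param.env, Param.name]

theorem SubstTyped.of_bindParams {ps : List (Param S)} {vs : List (Val S)} {σ : Subst S}
    (hvs : RowHasSort vs (ps.map Param.ty)) (hnd : (ps.map Param.name).Nodup)
    (hσ : bindParams ps vs = some σ) : SubstTyped D σ (paramsEnv ps) .empty := by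
  induction ps generalizing vs σ with
  | nil =>
    cases hvs
    rw [bindParams] at hσ
    cases hσ
    exact .empty
  | cons p ps ih =>
    rcases hvs with _ | ⟨hv, hvs⟩
    obtain ⟨hp, hps⟩ := List.nodup_cons.1 hnd
    rw [paramsEnv_cons]
    cases p with
    | dvar x τ =>
      rw [bindParams] at hσ
      obtain ⟨σ', hσ', rfl⟩ := Option.map_eq_some_iff.1 hσ
      exact (ih hvs hps hσ').single_append (by rw [dom_paramsEnv]; exact hp) hv
    | lvar u =>
      obtain ⟨l, rfl⟩ := hv.exists_loc
      rw [bindParams] at hσ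
      obtain ⟨σ', hσ', rfl⟩ := Option.map_eq_some_iff.1 hσ
      exact (ih hvs hps hσ').singleLoc_append u l

/-! ### Evaluation of closed phrases -/

theorem mapM_eq_some_of_forall₂ {α β : Type} {f : α → Option β} {as : List α} {bs : List β}
    (h : List.Forall₂ (fun a b => f a = some b) as bs) : as.mapM f = some bs := by
  induction h with
  | nil => rfl
  | cons h _ ih => simp [List.mapM_cons, h, ih]

theorem Val.HasSort.exists_data {v : Val S} {τ : DTy} (h : v.HasSort (.data τ)) :
    ∃ d, v = .data d ∧ d.ty = τ := by
  cases v with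
  | data d => exact ⟨d, rfl, h⟩
  | mset m => exact h.elim

theorem ExprTyped.exists_eval {e : Expr S} {τ : MTy} (h : ExprTyped .empty e τ) :
    ∃ v, e.eval = some v ∧ v.HasSort τ := by
  induction h with
  | dvar h => simp [TyEnv.empty] at h
  | lvar h => simp [TyEnv.empty] at h
  | @const v τ h => exact ⟨v, by rw [Expr.eval, if_pos ⟨τ, h⟩], h⟩
  | concat _ _ ih₁ ih₂ =>
    obtain ⟨v₁, h₁, hv₁⟩ := ih₁
    obtain ⟨v₂, h₂, hv₂⟩ := ih₂
    rcases v₁ with (_ | a | _ | _) | _ <;> simp [Val.HasSort, DVal.ty] at hv₁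
    rcases v₂ with (_ | b | _ | _) | _ <;> simp [Val.HasSort, DVal.ty] at hv₂
    exact ⟨.data (.str (a ++ b)), by rw [Expr.eval, h₁, h₂], rfl⟩
  | @arith op _ _ _ _ ih₁ ih₂ =>
    obtain ⟨v₁, h₁, hv₁⟩ := ih₁
    obtain ⟨v₂, h₂, hv₂⟩ := ih₂
    rcases v₁ with (a | _ | _ | _) | _ <;> simp [Val.HasSort, DVal.ty] at hv₁
    rcases v₂ with (b | _ | _ | _) | _ <;> simp [Val.HasSort, DVal.ty] at hv₂
    exact ⟨.data (.num (op.apply a b)), by rw [Expr.eval, h₁, h₂], rfl⟩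
  | @mset es τ _ ih =>
    have : ∃ ds : List (DVal S), List.Forall₂ (fun e d => e.eval = some (.data d)) es ds ∧
        ∀ d ∈ ds, d.ty = τ := by
      clear * - ih
      induction es with
      | nil => exact ⟨[], .nil, by simp⟩
      | cons e es ihes =>
        obtain ⟨v, hv, hs⟩ := ih e (by simp)
        obtain ⟨d, rfl, hd⟩ := hs.exists_data
        obtain ⟨ds, hds, hty⟩ := ihes fun e he => ih e (by simp [he])
        exact ⟨d :: ds, .cons hv hds, by simpa [hd] using hty⟩
    obtain ⟨ds, hds, hty⟩ := this
    refine ⟨.mset ds, ?_, by simpa [Val.HasSort] using hty⟩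
    rw [Expr.eval, evalMset, mapM_eq_some_of_forall₂ (bs := ds)]
    · simp only
      rw [if_pos ⟨τ, hty⟩]
    · rw [List.forall₂_map_left_iff]
      exact hds.imp fun e d h => by simp only [h]

theorem PredTyped.exists_eval {ψ : Pred S} (h : PredTyped .empty ψ) : ∃ b, ψ.eval = some b := by
  induction h with
  | tt => exact ⟨_, by rw [Pred.eval]⟩
  | cmp h₁ h₂ =>
    obtain ⟨v₁, he₁, hv₁⟩ := h₁.exists_eval
    obtain ⟨v₂, he₂, hv₂⟩ := h₂.exists_eval
    obtain ⟨d₁, rfl, hd₁⟩ := hv₁.exists_data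
    obtain ⟨d₂, rfl, hd₂⟩ := hv₂.exists_data
    simp [Pred.eval, he₁, he₂, hd₁, hd₂]
  | mem h₁ h₂ =>
    obtain ⟨v₁, he₁, hv₁⟩ := h₁.exists_eval
    obtain ⟨v₂, he₂, hv₂⟩ := h₂.exists_eval
    obtain ⟨d, rfl, hd⟩ := hv₁.exists_data
    cases v₂ with
    | data => exact hv₂.elim
    | mset m =>
      have hm : ∀ d' ∈ m, d'.ty = d.ty := fun d' hd' => (hv₂ d' hd').trans hd.symm
      simp only [Pred.eval, he₁, he₂, if_pos hm]
      exact ⟨_, rfl⟩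
  | neg _ ih =>
    obtain ⟨b, hb⟩ := ih
    exact ⟨!b, by simp [Pred.eval, hb]⟩
  | and _ _ ih₁ ih₂ =>
    obtain ⟨b₁, h₁⟩ := ih₁
    obtain ⟨b₂, h₂⟩ := ih₂
    exact ⟨b₁ && b₂, by rw [Pred.eval, h₁, h₂]⟩

theorem TupleTyped.exists_eval {t : Tuple S} {sk : Schema} (h : TupleTyped .empty t sk) :
    ∃ v, t.eval = some v ∧ RowHasSort v sk := by
  unfold TupleTyped at h
  have : ∃ v, List.Forall₂ (fun e v => Expr.eval e = some v) t v ∧ RowHasSort v sk := by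
    induction h with
    | nil => exact ⟨[], .nil, .nil⟩
    | cons h _ ih =>
      obtain ⟨v, hv, hs⟩ := h.exists_eval
      obtain ⟨vs, hvs, hss⟩ := ih
      exact ⟨v :: vs, .cons hv hvs, .cons hs hss⟩
  obtain ⟨v, hv, hs⟩ := this
  exact ⟨v, mapM_eq_some_of_forall₂ hv, hs⟩

/-- A well-typed predicate does not evaluate to `err` at a row of the schema of its template. -/
theorem PredTyped.evalAt_ne_none {ψ : Pred S} {T : Template S} {t : Row S} {sk : Schema}
    (hT : T.HasSort sk) (hψ : PredTyped (TyEnv.empty.ext (T.env sk)) ψ) (ht : RowHasSort t sk) :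
    ψ.evalAt T t ≠ none := by
  -- Any schema map will do: expressions contain no tables.
  obtain ⟨σ, hσ, hσt⟩ := exists_match (D := fun _ => none) hT ht
  rw [TyEnv.empty_ext] at hψ
  obtain ⟨b, hb⟩ := (hψ.subst hσt).exists_eval
  simp [Pred.evalAt, hσ, hb]

theorem TupleTyped.exists_evalAt {e : Tuple S} {T : Template S} {t : Row S} {sk k : Schema}
    (hT : T.HasSort sk) (he : TupleTyped (TyEnv.empty.ext (T.env sk)) e k)
    (ht : RowHasSort t sk) : ∃ v, e.evalAt T t = some v ∧ RowHasSort v k := by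
  -- Any schema map will do: expressions contain no tables.
  obtain ⟨σ, hσ, hσt⟩ := exists_match (D := fun _ => none) hT ht
  rw [TyEnv.empty_ext] at he
  obtain ⟨v, hv, hs⟩ := (he.subst hσt).exists_eval
  exact ⟨v, by simp [Tuple.evalAt, hσ, hv], hs⟩

theorem Template.HasSort.match_ne_none {T : Template S} {t : Row S} {sk : Schema}
    (hT : T.HasSort sk) (ht : RowHasSort t sk) : T.match t ≠ none := by
  obtain ⟨σ, hσ, _⟩ := exists_match (D := fun _ => none) hT ht
  simp [hσ]

theorem rowHasSort_of_mem_selectRows {T : Template S} {ψ : Pred S} {e : Tuple S} {R : Data S}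
    {sk k : Schema} (hT : T.HasSort sk) (he : TupleTyped (TyEnv.empty.ext (T.env sk)) e k)
    (hR : ∀ t ∈ R, RowHasSort t sk) {t : Row S} (ht : t ∈ selectRows T ψ e R) :
    RowHasSort t k := by
  obtain ⟨t', ht', h⟩ := (Multiset.mem_filterMap _ _).1 ht
  obtain ⟨v, hv, hs⟩ := he.exists_evalAt hT (hR t' ht')
  split_ifs at h
  rw [hv] at h
  cases h
  exact hs

/-! ### Products of tables -/

theorem tabSafe_of_mem_tablesNet {L : List (LocTable S)} (h : (tablesNet L).Safe Δ W D)
    {l : S.Loc} {I : Interface S} {R : Data S} (hL : (l, I, R) ∈ L) : TabSafe D I R := by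
  induction L with
  | nil => cases hL
  | cons p L ih =>
    rcases List.mem_cons.1 hL with rfl | hL
    · exact h.1
    · exact ih h.2 hL

theorem TabSafe.schema_eq {I : Interface S} {R : Data S} (h : TabSafe D I R) {tid : S.Tid}
    (htid : I.tid = some tid) : D tid = some I.sk := by
  obtain ⟨_, tid', htid', hsk⟩ := h
  rw [htid] at htid'
  cases htid'
  exact hsk

/-- The table that a safe table term stands for is safe as a concrete table. -/
theorem Resolves.safe {L : List (LocTable S)} (hL : (tablesNet L).Safe Δ W D) {TB : Table S}
    {r : Schema × Data S} (h : Resolves L TB r) {Γ : TyEnv S} {sk : Schema}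
    (hTB : TB.Safe D Γ sk) :
    (∀ t ∈ r.2, RowHasSort t sk) ∧
      List.Forall₂ (fun τ τ' => τ = MTy.data .loc ↔ τ' = MTy.data .loc) r.1 sk := by
  cases h with
  | ref hmem htid =>
    have hs := tabSafe_of_mem_tablesNet hL hmem
    obtain rfl : _ = sk := Option.some.inj ((hs.schema_eq htid).symm.trans hTB)
    exact ⟨hs.1, List.forall₂_same.2 fun _ _ => Iff.rfl⟩
  | conc => exact hTB

theorem forall₂_of_common_left {α β γ : Type} {p : α → β → Prop} {q : α → γ → Prop} {r : β → γ → Prop}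
    (hr : ∀ a b c, p a b → q a c → r b c) {as : List α} {bs : List β} {cs : List γ}
    (hp : List.Forall₂ p as bs) (hq : List.Forall₂ q as cs) : List.Forall₂ r bs cs := by
  induction hp generalizing cs with
  | nil => cases hq; exact .nil
  | cons h _ ih => rcases hq with _ | ⟨h', hq⟩; exact .cons (hr _ _ _ h h') (ih hq)

theorem rowHasSort_of_mem_prodData {rs : List (Schema × Data S)} {sks : List Schema}
    (h : List.Forall₂ (fun r sk => ∀ t ∈ r.2, RowHasSort t sk) rs sks) {t : Row S}
    (ht : t ∈ prodData rs) : RowHasSort t sks.flatten := by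
  induction h generalizing t with
  | nil =>
    rw [prodData, Multiset.mem_singleton] at ht
    subst ht
    exact .nil
  | cons hr _ ih =>
    rw [prodData] at ht
    obtain ⟨p, hp, rfl⟩ := Multiset.mem_map.1 ht
    rw [Multiset.mem_product] at hp
    exact List.rel_append (hr _ hp.1) (ih hp.2)

theorem forall₂_prodSk {p : MTy → MTy → Prop} {rs : List (Schema × Data S)} {sks : List Schema}
    (h : List.Forall₂ (fun r sk => List.Forall₂ p r.1 sk) rs sks) :
    List.Forall₂ p (prodSk rs) sks.flatten :=
  List.rel_flatten (List.forall₂_map_left_iff.2 h)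

/-- `T ⊩ sk` depends only on the places where `sk` has the type `Loc`. -/
theorem Template.HasSort.of_forall₂ {T : Template S} {sk sk' : Schema} (hT : T.HasSort sk)
    (h : List.Forall₂ (fun τ τ' => τ = MTy.data .loc ↔ τ' = MTy.data .loc) sk' sk) :
    T.HasSort sk' := by
  refine forall₂_of_common_left (fun τ W τ' hW hτ => ?_) (List.Forall₂.flip hT) h.flip
  cases W
  · exact fun h => hW (hτ.1 h)
  · exact hτ.2 hW

/-- The schema that `select` computes for a tuple has `Loc` at the same places as every type of the
tuple. It need not be equal to that type, because an empty multiset has every type `{τ}`. -/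
theorem SkProj.forall₂ {sk sk' k : Schema} {T : Template S} {t : Tuple S} {Γ : TyEnv S}
    (h : SkProj sk T t sk') (hT : T.HasSort sk) (ht : TupleTyped Γ t k) :
    List.Forall₂ (fun τ τ' => τ = MTy.data .loc ↔ τ' = MTy.data .loc) sk' k := by
  have hW : ∀ {τ : MTy} {W : Field S}, (τ, W) ∈ sk.zip T.fields → W.HasSort τ :=
    fun h => (List.forall₂_iff_zip.1 (List.Forall₂.flip hT)).2 h
  refine forall₂_of_common_left (fun e τ τ' he hτ' => ?_) h.2.2 ht
  rcases he with (⟨v, rfl, hv⟩ | ⟨ds, rfl, hv⟩) | ⟨x, rfl, hx⟩ | ⟨u, rfl, hu⟩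
  · cases hτ' with
    | const hv' =>
      cases v <;> cases τ <;> cases τ' <;> simp_all [Val.HasSort]
  · cases hτ' with
    | mset => cases τ <;> simp_all [Val.HasSort]
  · cases hτ' with
    | dvar _ hτ' => exact iff_of_false (hW hx) hτ'
  · cases hτ' with
    | lvar _ => exact iff_of_true (hW hu) rfl

/-! ### Subject reduction -/

theorem not_delErr {T : Template S} {ψ : Pred S} {sk : Schema} {R : Data S} (hT : T.HasSort sk)
    (hψ : PredTyped (TyEnv.empty.ext (T.env sk)) ψ) (hR : ∀ t ∈ R, RowHasSort t sk) :
    ¬ DelErr T ψ sk R := by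
  rintro (h | ⟨t, ht, h | h⟩)
  · exact h hT
  · exact hT.match_ne_none (hR t ht) h
  · exact hψ.evalAt_ne_none hT (hR t ht) h

theorem not_updErr {T : Template S} {ψ : Pred S} {e : Tuple S} {sk : Schema} {R : Data S}
    (hT : T.HasSort sk) (hψ : PredTyped (TyEnv.empty.ext (T.env sk)) ψ)
    (he : TupleTyped (TyEnv.empty.ext (T.env sk)) e sk) (hR : ∀ t ∈ R, RowHasSort t sk) :
    ¬ UpdErr T ψ e sk R := by
  rintro (h | ⟨t, ht, h | h | h | ⟨_, h⟩⟩)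
  · exact h hT
  · exact hT.match_ne_none (hR t ht) h
  · exact hψ.evalAt_ne_none hT (hR t ht) h
  · obtain ⟨v, hv, _⟩ := he.exists_evalAt hT (hR t ht)
    simp [hv] at h
  · exact h (he.exists_evalAt hT (hR t ht))

theorem not_aggrErr {T T' : Template S} {ψ : Pred S} {f : Agg S} {R : Data S}
    (hT : T.HasSort f.dom) (hψ : PredTyped (TyEnv.empty.ext (T.env f.dom)) ψ)
    (hT' : T'.HasSort f.cod) (hR : ∀ t ∈ R, RowHasSort t f.dom) :
    ¬ AggrErr T ψ f T' f.dom R := by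
  rintro (h | ⟨t, ht, h | h | h | h⟩)
  · exact h hT
  · exact hT.match_ne_none (hR t ht) h
  · exact hψ.evalAt_ne_none hT (hR t ht) h
  · exact h (hR t ht)
  · exact h hT'

theorem not_selErr {T : Template S} {ψ : Pred S} {e : Tuple S} {sk sk' k : Schema} {R : Data S}
    (hT' : T.HasSort sk') (hT : T.HasSort sk) (hψ : PredTyped (TyEnv.empty.ext (T.env sk)) ψ)
    (he : TupleTyped (TyEnv.empty.ext (T.env sk)) e k) (hR : ∀ t ∈ R, RowHasSort t sk) :
    ¬ SelErr T ψ e sk' R := by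
  rintro (h | ⟨t, ht, h | h | h⟩)
  · exact h hT'
  · exact hT.match_ne_none (hR t ht) h
  · exact hψ.evalAt_ne_none hT (hR t ht) h
  · obtain ⟨v, hv, _⟩ := he.exists_evalAt hT (hR t ht)
    simp [hv] at h

theorem not_forErr {T : Template S} {ψ : Pred S} {sk : Schema} {R : Data S} (hT : T.HasSort sk)
    (hψ : PredTyped (TyEnv.empty.ext (T.env sk)) ψ) (hR : ∀ t ∈ R, RowHasSort t sk) :
    ¬ ForErr T ψ R :=
  fun h => not_delErr hT hψ hR (.inr h)

theorem Net.safe_proc {l : S.Loc} {P : Proc S} :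
    (Net.node l (.proc P)).Safe Δ W D ↔ P.Safe Δ W D .empty := Iff.rfl

theorem Net.safe_tab {l : S.Loc} {I : Interface S} {R : Data S} :
    (Net.node l (.tab I R)).Safe Δ W D ↔ TabSafe D I R := Iff.rfl

theorem Net.safe_par {N₁ N₂ : Net S} :
    (Net.par N₁ N₂).Safe Δ W D ↔ N₁.Safe Δ W D ∧ N₂.Safe Δ W D := Iff.rfl

/-- Subject reduction. The induction covers the rule for sequences as well, since safety of
`P₁; P₂` in parallel with a net gives safety of `P₁` in parallel with that net. -/
theorem Step.safe (hW : ∀ A ∈ W, ∀ d, Δ A = some d → d.body.Safe Δ W D d.env)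
    {E N N' : Net S} (h : Step Δ E N N') (hN : N.Safe Δ W D) : N'.Safe Δ W D := by
  induction h with
  | ins_err htid h =>
    simp only [Net.safe_par, Net.safe_proc, Net.safe_tab, Proc.Safe, Act.Safe] at hN
    obtain ⟨⟨k, ⟨sk, hsk, ht⟩, hP⟩, hI⟩ := hN
    obtain rfl := Option.some.inj ((hI.schema_eq htid).symm.trans hsk)
    exact h ht.exists_eval
  | ins htid hv h =>
    simp only [Net.safe_par, Net.safe_proc, Net.safe_tab, Proc.Safe, Act.Safe, Act.env,
      TyEnv.ext_empty] at hN
    obtain ⟨⟨k, _, hP⟩, hI⟩ := hN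
    refine ⟨hP, fun t ht => ?_, hI.2⟩
    rcases Multiset.mem_add.1 ht with ht | ht
    · exact hI.1 t ht
    · rw [Multiset.mem_singleton.1 ht]; exact h
  | del_err htid h =>
    simp only [Net.safe_par, Net.safe_proc, Net.safe_tab, Proc.Safe, Act.Safe] at hN
    obtain ⟨⟨k, ⟨sk, hsk, hT, hψ⟩, hP⟩, hI⟩ := hN
    obtain rfl := Option.some.inj ((hI.schema_eq htid).symm.trans hsk)
    exact not_delErr hT hψ hI.1 h
  | del htid h =>
    simp only [Net.safe_par, Net.safe_proc, Net.safe_tab, Proc.Safe, Act.Safe, Act.env,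
      TyEnv.ext_empty] at hN
    obtain ⟨⟨k, _, hP⟩, hI⟩ := hN
    exact ⟨hP, fun t ht => hI.1 t (Multiset.mem_of_mem_filter ht), hI.2⟩
  | sel_err hrs h =>
    simp only [Net.safe_par, Net.safe_proc, Proc.Safe, Act.Safe] at hN
    obtain ⟨⟨k, ⟨sks, hTBs, hT, hψ, ht⟩, hP⟩, hL⟩ := hN
    have hr := forall₂_of_common_left (fun _ _ _ h h' => h.safe hL h') hrs hTBs
    exact not_selErr (hT.of_forall₂ (forall₂_prodSk (hr.imp fun _ _ h => h.2))) hT hψ ht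
      (fun t ht => rowHasSort_of_mem_prodData (hr.imp fun _ _ h => h.1) ht) h
  | sel hrs _ hsk =>
    simp only [Net.safe_par, Net.safe_proc, Proc.Safe, Act.Safe, Act.env, TyEnv.empty_ext] at hN
    obtain ⟨⟨k, ⟨sks, hTBs, hT, hψ, ht⟩, hP⟩, hL⟩ := hN
    have hr := forall₂_of_common_left (fun _ _ _ h h' => h.safe hL h') hrs hTBs
    refine ⟨hP.subst (SubstTyped.singleTab ⟨fun t' ht' => ?_, ?_⟩ _), hL⟩
    · rw [← TyEnv.empty_ext (Template.env _ _)] at ht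
      exact rowHasSort_of_mem_selectRows hT ht
        (fun t ht => rowHasSort_of_mem_prodData (hr.imp fun _ _ h => h.1) ht) ht'
    · exact hsk.forall₂ (hT.of_forall₂ (forall₂_prodSk (hr.imp fun _ _ h => h.2))) ht
  | upd_err htid h =>
    simp only [Net.safe_par, Net.safe_proc, Net.safe_tab, Proc.Safe, Act.Safe] at hN
    obtain ⟨⟨k, ⟨sk, hsk, hT, hψ, ht⟩, hP⟩, hI⟩ := hN
    obtain rfl := Option.some.inj ((hI.schema_eq htid).symm.trans hsk)
    exact not_updErr hT hψ ht hI.1 h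
  | upd htid h =>
    simp only [Net.safe_par, Net.safe_proc, Net.safe_tab, Proc.Safe, Act.Safe, Act.env,
      TyEnv.ext_empty] at hN
    obtain ⟨⟨k, ⟨sk, hsk, hT, hψ, ht⟩, hP⟩, hI⟩ := hN
    obtain rfl := Option.some.inj ((hI.schema_eq htid).symm.trans hsk)
    refine ⟨hP, fun t' ht' => ?_, hI.2⟩
    rcases Multiset.mem_add.1 ht' with ht' | ht'
    · exact hI.1 t' (Multiset.mem_of_mem_filter ht')
    · exact rowHasSort_of_mem_selectRows hT ht hI.1 ht'
  | aggr_err htid h =>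
    simp only [Net.safe_par, Net.safe_proc, Net.safe_tab, Proc.Safe, Act.Safe] at hN
    obtain ⟨⟨k, ⟨hsk, hT, hψ, hT'⟩, hP⟩, hI⟩ := hN
    have hI' := hI.1
    rw [Option.some.inj ((hI.schema_eq htid).symm.trans hsk)] at hI' h
    exact not_aggrErr hT hψ hT' hI' h
  | @aggr E l₁ l₂ tid T T' ψ f P I R σ htid h hσ =>
    simp only [Net.safe_par, Net.safe_proc, Net.safe_tab, Proc.Safe, Act.Safe, Act.env,
      TyEnv.empty_ext] at hN
    obtain ⟨⟨k, ⟨hsk, hT, hψ, hT'⟩, hP⟩, hI⟩ := hN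
    have hI' := hI.1
    rw [Option.some.inj ((hI.schema_eq htid).symm.trans hsk)] at hI'
    have hf : RowHasSort (f.fn (rowsWhere T ψ R)) f.cod :=
      f.maps _ fun t ht => hI' t (Multiset.mem_of_mem_filter ht)
    exact ⟨hP.subst (SubstTyped.of_match hT' hf hσ), hI⟩
  | create _ =>
    simp only [Net.safe_par, Net.safe_proc, Proc.Safe, Act.Safe, Act.env, TyEnv.ext_empty] at hN
    obtain ⟨⟨k, hsk, hP⟩, _⟩ := hN
    exact ⟨hP, fun t ht => absurd ht (Multiset.notMem_zero t), _, rfl, hsk⟩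
  | create_skip _ =>
    simp only [Net.safe_par, Net.safe_proc, Proc.Safe, Act.env, TyEnv.ext_empty] at hN ⊢
    obtain ⟨⟨k, _, hP⟩, h⟩ := hN
    exact ⟨hP, h⟩
  | drop _ =>
    simp only [Net.safe_par, Net.safe_proc, Proc.Safe, Act.env, TyEnv.ext_empty] at hN ⊢
    obtain ⟨⟨k, _, hP⟩, _⟩ := hN
    exact ⟨hP, trivial⟩
  | eval _ =>
    simp only [Net.safe_par, Net.safe_proc, Proc.Safe, Act.Safe, Act.env,
      TyEnv.ext_empty] at hN ⊢
    obtain ⟨⟨k, hP, hP'⟩, _⟩ := hN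
    exact ⟨hP', hP⟩
  | for_tt hmin hσ _ =>
    classical
    simp only [Net.safe_proc, Proc.Safe] at hN ⊢
    obtain ⟨sk, hTB, hT, hψ, hP⟩ := hN
    refine ⟨?_, sk, ⟨fun t ht => hTB.1 t (Multiset.mem_of_mem_erase ht), hTB.2⟩, hT, hψ, hP⟩
    rw [TyEnv.empty_ext] at hP
    exact hP.subst (SubstTyped.of_match hT (hTB.1 _ hmin.1) hσ)
  | for_err _ h =>
    simp only [Net.safe_proc, Proc.Safe] at hN
    obtain ⟨sk, hTB, hT, hψ, _⟩ := hN
    exact not_forErr hT hψ hTB.1 h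
  | for_ff _ _ => rw [Net.safe_proc, Proc.Safe]; trivial
  | seq_tt _ _ ih =>
    simp only [Net.safe_par, Net.safe_proc, Proc.Safe] at hN ih ⊢
    obtain ⟨h₁, h₂⟩ := ih ⟨hN.1.1, hN.2⟩
    exact ⟨⟨h₁, hN.1.2⟩, h₂⟩
  | seq_ff _ ih =>
    simp only [Net.safe_par, Net.safe_proc, Proc.Safe] at hN ih ⊢
    exact ⟨hN.1.2, (ih ⟨hN.1.1, hN.2⟩).2⟩
  | call hd hvs hσ =>
    simp only [Net.safe_proc, Proc.Safe] at hN ⊢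
    obtain ⟨hA, d', hd', hes⟩ := hN
    obtain rfl := Option.some.inj (hd.symm.trans hd')
    obtain ⟨v, hv, hs⟩ := hes.exists_eval
    obtain rfl := Option.some.inj (hvs.symm.trans hv)
    exact (hW _ hA _ hd).subst (SubstTyped.of_bindParams hs (ProcDef.distinct _) hσ)
  | par _ ih => exact ⟨ih hN.1, hN.2⟩
  | res _ ih => exact ih hN
  | equiv h₁₂ _ h₃₄ ih => exact h₃₄.safe_iff.1 (ih (h₁₂.safe_iff.1 hN))

theorem Steps.safe (hW : ∀ A ∈ W, ∀ d, Δ A = some d → d.body.Safe Δ W D d.env)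
    {N N' : Net S} (h : Steps Δ N N') (hN : N.Safe Δ W D) : N'.Safe Δ W D := by
  unfold Steps at h
  induction h with
  | refl => exact hN
  | tail _ h ih => exact h.safe hW ih

end
end KlaimDB

theorem mainTheorem2 {S : KlaimDB.Names} (Δ : KlaimDB.Defs S) (D : KlaimDB.SchemaMap S)
    (N N' : KlaimDB.Net S) (hN : KlaimDB.WellTyped Δ D KlaimDB.TyEnv.empty N)
    (hsteps : KlaimDB.Steps Δ N N') : KlaimDB.Ok N' := by
  obtain ⟨W, hW, hN⟩ := hN
  exact (hsteps.safe (fun A hA d hd => (hW A hA d hd).safe) hN.safe).ok
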